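/- **Setting.** There are $n$ papers and $m$ independent reviewers, $m$ even. $\mathcal J\subseteq[n]$ is the set of papers with a given property, $\overline{\mathcal J}$ its complement, and $w_j=1$ if $j\in\mathcal J$, $w_j=-1$ otherwise. Let $\pi^{(\mathrm{sb})}_{ij},\pi^{(\mathrm{db})}_{ij}\in[0,1]$ be the probabilities that reviewer $i$, if assigned to paper $j$, recommends its acceptance in the single-blind (SB), respectively double-blind (DB), condition. Decisions of different reviewers are independent (decisions of one reviewer may depend on each other). The absolute bias problem is to test $H_0:\ \pi^{(\mathrm{sb})}_{ij}=\pi^{(\mathrm{db})}_{ij}$ for all $i,j$, against $H_1:\ \pi^{(\mathrm{sb})}_{ij}\ge\pi^{(\mathrm{db})}_{ij}$ for all $i$ and all $j\in\mathcal J$, and $\pi^{(\mathrm{sb})}_{ij}\le\pi^{(\mathrm{db})}_{ij}$ for all $i$ and all $j\in\overline{\mathcal J}$, with at least one strict inequality. $H_1$ holds with margin $\delta$ if in addition $|\pi^{(\mathrm{sb})}_{ij}-\pi^{(\mathrm{db})}_{ij}|>\delta$ for all $i,j$. **Experiment** (paper load $\lambda\ge1$, reviewer load $\mu\ge 1$).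 (1) Reviewers bid blindly, before the allocation to conditions. (2) If $m>2n$, choose $2n$ reviewers uniformly at random; if $m<2n$, choose $m/2$ papers such that the numbers of chosen papers from $\mathcal J$ and from $\overline{\mathcal J}$ are as close to each other as possible; then an arbitrary (possibly randomized) assignment algorithm, which may use the bids, assigns each of the participating papers to two of the participating reviewers, each of these reviewers getting one paper. Call this partial assignment $A^*$. (3) For each paper of $A^*$, independently, a fair coin decides which of its two reviewers is allocated to SB and which to DB; of the remaining reviewers a uniformly random half is allocated to SB and the other half to DB. (4) The algorithm extends $A^*$ to an assignment in which each paper has $\lambda$ SB and $\lambda$ DB reviewers and each reviewer has at most $\mu$ papers, and the reviewers decide. (5) $\mathcal T$ is the set of tuples $(j,Y_j,X_j,w_j)$, $j$ a paper of $A^*$, where $Y_j,X_j\in\{0,1\}$ are the decisions for $j$ of the SB and of the DB reviewer in its pair (1 = accept). (6) A test is run on $\mathcal T$. **Tests** (level $\alpha\in(0,1)$). *Disagreement*: let $U$ (resp. $V$) be the array of the $Y_j$ over the tuples of $\mathcal T$ with $Y_j\ne X_j$ and $w_j=1$ (resp. $w_j=-1$). If $U$ or $V$ is empty, keep the null. Otherwise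 run the permutation test with statistic $|\tau|$, $\tau=\frac1{|U|}\sum_rU_r-\frac1{|V|}\sum_rV_r$: reject if and only if the proportion of the permutations of the $|U|+|V|$ pooled entries for which $|\tau|$ is at least its observed value is at most $\alpha$. *Counting*: let $U$ (resp. $V$) be the array of the $Y_j-X_j$ over the tuples of $\mathcal T$ with $w_j=1$ (resp. $w_j=-1$). If $U$ or $V$ is empty, keep the null. Otherwise reject if and only if $|\gamma|>\sqrt{2\left(|U|^{-1}+|V|^{-1}\right)\log(2/\alpha)}$, where $\gamma=\frac1{|U|}\sum_rU_r-\frac1{|V|}\sum_rV_r$. **Theorem.** Let $\alpha\in(0,1)$ and $\lambda,\mu\ge1$. Each of the Disagreement and Counting tests, applied to the experiment above: (i) (Type-I error) rejects with probability at most $\alpha$ whenever $H_0$ holds; (ii) (non-trivial power) for all $\varepsilon>0$ and $\delta>0$ there is $n_0$ (which depends only on $\varepsilon,\delta$ and on $\alpha,\lambda,\mu$) such that, whenever $\min\{|\mathcal J|,|\overline{\mathcal J}|\}>n_0$ and $H_1$ holds with margin $\delta$, the test rejects with probability at least $1-\varepsilon$. -/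

import Mathlib

open scoped ENNReal

noncomputable section

namespace BiasTest

/-! ## Tests on tuple sets -/

/-- A finite set of tuples `(j, Y j, X j, w j)`, one for every paper `j ∈ papers`: `Y j` is the
decision of an SB reviewer, `X j` the decision of a DB reviewer (`true` is "accept"), and `w j` is
the indicator of the property (`1` if the paper satisfies it, `-1` if not).
The values outside `papers` play no role. -/
structure TupleSet (n : ℕ) where
  papers : Finset (Fin n)
  Y : Fin n → Bool
  X : Fin n → Bool
  w : Fin n → ℤ

/-- A decision as a number: accept is `1`, reject is `0`. -/
def num (b : Bool) : ℝ := if b then 1 else 0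

/-- Mean of the entries `f` over the index set `U` minus their mean over the index set `V`. -/
def meanDiff {n : ℕ} (U V : Finset (Fin n)) (f : Fin n → ℝ) : ℝ :=
  (∑ j ∈ U, f j) / (U.card : ℝ) - (∑ j ∈ V, f j) / (V.card : ℝ)

/-- Two-sided p-value of the permutation test for exchangeability of the entries `f` of two arrays
with (disjoint) index sets `U` and `V`: the proportion, among all permutations of the pooled
entries, of those for which the absolute value of the statistic `meanDiff` is at least as large as
the observed one. -/
def permutationPValue {n : ℕ} (U V : Finset (Fin n)) (f : Fin n → ℝ) : ℝ :=
  (((Finset.univ : Finset (Equiv.Perm {j : Fin n // j ∈ U ∪ V})).filter fun σ =>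
      |meanDiff U V f| ≤ |meanDiff U V (f ∘ Equiv.Perm.ofSubtype σ)|).card : ℝ) /
    (Fintype.card (Equiv.Perm {j : Fin n // j ∈ U ∪ V}) : ℝ)

/-- The Disagreement test at level `α` rejects: the arrays hold the SB decisions of the papers with
disagreeing reviewers, and the permutation test rejects if its p-value is at most `α`.
The null is kept if one of the arrays is empty. -/
def disagreementRejects (α : ℝ) {n : ℕ} (T : TupleSet n) : Prop :=
  let U := T.papers.filter fun j => T.Y j ≠ T.X j ∧ T.w j = 1
  let V := T.papers.filter fun j => T.Y j ≠ T.X j ∧ T.w j = -1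
  U.Nonempty ∧ V.Nonempty ∧ permutationPValue U V (fun j => num (T.Y j)) ≤ α

/-- The Counting test at level `α` rejects: the arrays hold the differences of the SB and the DB
decision. The null is kept if one of the arrays is empty. -/
def countingRejects (α : ℝ) {n : ℕ} (T : TupleSet n) : Prop :=
  let U := T.papers.filter fun j => T.w j = 1
  let V := T.papers.filter fun j => T.w j = -1
  U.Nonempty ∧ V.Nonempty ∧
    Real.sqrt (2 * ((U.card : ℝ)⁻¹ + (V.card : ℝ)⁻¹) * Real.log (2 / α)) <
      |meanDiff U V (fun j => num (T.Y j) - num (T.X j))|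

/-! ## The design of the experiment -/

/-- A partial assignment: a paper gets no reviewers, or a pair of reviewers. -/
abbrev PairAssignment (n m : ℕ) := Fin n → Option (Fin m × Fin m)

/-- `a` assigns every paper of `P`, and no other paper, to two different reviewers from `R`, and
every reviewer of `R` to exactly one paper. -/
structure IsPairing {n m : ℕ} (P : Finset (Fin n)) (R : Finset (Fin m))
    (a : PairAssignment n m) : Prop where
  selected : ∀ j, (a j).isSome ↔ j ∈ P
  two : ∀ j r, a j = some r → r.1 ≠ r.2 ∧ r.1 ∈ R ∧ r.2 ∈ R
  one : ∀ i ∈ R, ∃! j, ∃ r, a j = some r ∧ (i = r.1 ∨ i = r.2)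

/-- `P` consists of `k` papers, and among all sets of `k` papers its numbers (equivalently,
proportions) of papers from `J` and from the complement of `J` are as close as possible. -/
def IsBalancedSelection {n : ℕ} (J : Finset (Fin n)) (k : ℕ) (P : Finset (Fin n)) : Prop :=
  P.card = k ∧ ∀ Q : Finset (Fin n), Q.card = k →
    |((P ∩ J).card : ℤ) - ((P \ J).card : ℤ)| ≤ |((Q ∩ J).card : ℤ) - ((Q \ J).card : ℤ)|

/-- `A` (the set of reviewers of each paper) contains the partial assignment `a`, gives each paper
`lam` reviewers from the SB group `S` and `lam` reviewers from the DB group (the complement of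
`S`), and gives each reviewer at most `mu` papers. -/
structure IsCompletion {n m : ℕ} (lam mu : ℕ) (a : PairAssignment n m) (S : Finset (Fin m))
    (A : Fin n → Finset (Fin m)) : Prop where
  extends_pairs : ∀ j r, a j = some r → r.1 ∈ A j ∧ r.2 ∈ A j
  sb_load : ∀ j, (A j ∩ S).card = lam
  db_load : ∀ j, (A j \ S).card = lam
  reviewer_load : ∀ i, (Finset.univ.filter fun j => i ∈ A j).card ≤ mu

/-- The free choices in the experiment, which may all be randomized and may all use the bids (and
similarities) of type `β`: the law of the bids, which are made before the allocation to conditions;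
the selection of papers if there are too few reviewers; and the assignment algorithm, both for the
partial assignment of a set of papers to a set of reviewers and for its completion once the set of
SB reviewers is known. -/
structure Design (n m : ℕ) (β : Type) where
  bidLaw : PMF β
  selectPapers : β → PMF (Finset (Fin n))
  assign : β → Finset (Fin n) → Finset (Fin m) → PMF (PairAssignment n m)
  complete : β → PairAssignment n m → Finset (Fin m) → PMF (Fin n → Finset (Fin m))

/-- The papers and the reviewers that take part in the partial assignment. -/
def Design.pool {n m : ℕ} {β : Type} (D : Design n m β) (b : β) :
    PMF (Finset (Fin n) × Finset (Fin m)) :=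
  if h : 2 * n < m then
    (PMF.uniformOfFinset (Finset.powersetCard (2 * n) (Finset.univ : Finset (Fin m)))
      (Finset.powersetCard_nonempty.2 (by simpa using h.le))).map fun R => (Finset.univ, R)
  else if m < 2 * n then
    (D.selectPapers b).map fun P => (P, Finset.univ)
  else
    PMF.pure (Finset.univ, Finset.univ)

/-- The law of the partial assignment, given the bids. -/
def Design.pairing {n m : ℕ} {β : Type} (D : Design n m β) (b : β) : PMF (PairAssignment n m) :=
  (D.pool b).bind fun PR => D.assign b PR.1 PR.2

/-- The reviewers who have a paper in the partial assignment. -/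
def usedReviewers {n m : ℕ} (a : PairAssignment n m) : Finset (Fin m) :=
  Finset.univ.filter fun i => ∃ j r, a j = some r ∧ (i = r.1 ∨ i = r.2)

/-- The reviewers of the pairs that are allocated to SB by the coins `c`. -/
def coinSB {n m : ℕ} (a : PairAssignment n m) (c : Fin n → Bool) : Finset (Fin m) :=
  Finset.univ.filter fun i => ∃ j r, a j = some r ∧ i = if c j then r.1 else r.2

/-- The law of the set of SB reviewers, given the partial assignment: an independent fair coin for
each pair decides which of its reviewers is in SB (the other one is in DB), and a uniformly random
half of the remaining reviewers is in SB. -/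
def allocate {n m : ℕ} (a : PairAssignment n m) : PMF (Finset (Fin m)) :=
  (PMF.uniformOfFintype (Fin n → Bool)).bind fun c =>
    (PMF.uniformOfFinset
      (Finset.powersetCard ((usedReviewers a)ᶜ.card / 2) (usedReviewers a)ᶜ)
      (Finset.powersetCard_nonempty.2 (Nat.div_le_self _ _))).map fun H => coinSB a c ∪ H

/-- Every choice made by the design satisfies the constraints of the procedure. -/
structure Design.IsValid {n m : ℕ} {β : Type} (D : Design n m β) (lam mu : ℕ)
    (J : Finset (Fin n)) : Prop where
  select : m < 2 * n → ∀ b ∈ D.bidLaw.support, ∀ P ∈ (D.selectPapers b).support,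
    IsBalancedSelection J (m / 2) P
  assign : ∀ b ∈ D.bidLaw.support, ∀ PR ∈ (D.pool b).support,
    ∀ a ∈ (D.assign b PR.1 PR.2).support, IsPairing PR.1 PR.2 a
  complete : ∀ b ∈ D.bidLaw.support, ∀ a ∈ (D.pairing b).support, ∀ S ∈ (allocate a).support,
    ∀ A ∈ (D.complete b a S).support, IsCompletion lam mu a S A

/-! ## Reviewers' decisions -/

/-- The joint law of independent random elements with laws `p i`. -/
def independent {ι α : Type} [Fintype ι] [DecidableEq ι] [Fintype α] (p : ι → PMF α) :
    PMF (ι → α) :=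
  PMF.ofFintype (fun v => ∏ i, p i (v i)) (by
    have h : ∀ i, ∑ x, p i x = 1 := fun i => by
      rw [← tsum_fintype (L := .unconditional _)]
      exact (p i).tsum_coe
    have h2 := Finset.prod_univ_sum (fun _ : ι => (Finset.univ : Finset α)) (fun i x => p i x)
    rw [Fintype.piFinset_univ] at h2
    rw [← h2]
    simp [h])

/-- `sb i P` is the joint law of the decisions of reviewer `i` in the SB condition if `P` is the set
of papers assigned to her (decisions on other papers are never used), and `db i P` is the same for
the DB condition. The decisions of one reviewer may depend on each other. -/
structure ReviewModel (n m : ℕ) where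
  sb : Fin m → Finset (Fin n) → PMF (Fin n → Bool)
  db : Fin m → Finset (Fin n) → PMF (Fin n → Bool)

/-- `Psb i j` and `Pdb i j` are the probabilities that reviewer `i` recommends acceptance of paper
`j` if that paper is assigned to that reviewer in the SB and in the DB condition. -/
structure ReviewModel.HasAcceptanceProbabilities {n m : ℕ} (M : ReviewModel n m)
    (Psb Pdb : Matrix (Fin m) (Fin n) ℝ) : Prop where
  sb_mem : ∀ i j, Psb i j ∈ Set.Icc (0 : ℝ) 1
  db_mem : ∀ i j, Pdb i j ∈ Set.Icc (0 : ℝ) 1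
  sb_eq : ∀ i P, ∀ j ∈ P, ((M.sb i P).map fun v => v j) true = ENNReal.ofReal (Psb i j)
  db_eq : ∀ i P, ∀ j ∈ P, ((M.db i P).map fun v => v j) true = ENNReal.ofReal (Pdb i j)

/-- The joint law of all decisions, given the assignment `A` and the set `S` of SB reviewers:
different reviewers decide independently. -/
def ReviewModel.decisions {n m : ℕ} (M : ReviewModel n m) (A : Fin n → Finset (Fin m))
    (S : Finset (Fin m)) : PMF (Fin m → Fin n → Bool) :=
  independent fun i =>
    if i ∈ S then M.sb i (Finset.univ.filter fun j => i ∈ A j)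
    else M.db i (Finset.univ.filter fun j => i ∈ A j)

/-- The tuples for the papers of the partial assignment `a`, from the decisions `v` of the SB and
the DB reviewer of each pair. -/
def tuples {n m : ℕ} (J : Finset (Fin n)) (a : PairAssignment n m) (S : Finset (Fin m))
    (v : Fin m → Fin n → Bool) : TupleSet n where
  papers := Finset.univ.filter fun j => (a j).isSome
  Y := fun j => match a j with
    | some r => v (if r.1 ∈ S then r.1 else r.2) j
    | none => false
  X := fun j => match a j with
    | some r => v (if r.1 ∈ S then r.2 else r.1) j
    | none => false
  w := fun j => if j ∈ J then 1 else -1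

/-- The law of the set of tuples that the experiment hands to the test. -/
def experiment {n m : ℕ} {β : Type} (D : Design n m β) (M : ReviewModel n m)
    (J : Finset (Fin n)) : PMF (TupleSet n) :=
  D.bidLaw.bind fun b =>
    (D.pairing b).bind fun a =>
      (allocate a).bind fun S =>
        (D.complete b a S).bind fun A =>
          (M.decisions A S).map fun v => tuples J a S v

/-- The probability that the test with rejection region `reject` rejects the null. -/
def rejectionProbability {n m : ℕ} {β : Type} (D : Design n m β) (M : ReviewModel n m)
    (J : Finset (Fin n)) (reject : TupleSet n → Prop) : ℝ≥0∞ :=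
  (experiment D M J).toOuterMeasure {T | reject T}

/-! ## The absolute bias problem -/

/-- Null hypothesis: no difference between the conditions. -/
def AbsoluteNull {n m : ℕ} (Psb Pdb : Matrix (Fin m) (Fin n) ℝ) : Prop :=
  ∀ i j, Psb i j = Pdb i j

/-- Alternative hypothesis: bias in favor of the papers from `J`. -/
def AbsoluteAlternative {n m : ℕ} (J : Finset (Fin n)) (Psb Pdb : Matrix (Fin m) (Fin n) ℝ) :
    Prop :=
  (∀ i j, (j ∈ J → Pdb i j ≤ Psb i j) ∧ (j ∉ J → Psb i j ≤ Pdb i j)) ∧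
    ∃ i j, Psb i j ≠ Pdb i j

/-- The alternative hypothesis holds with margin `δ`. -/
def AlternativeWithMargin {n m : ℕ} (J : Finset (Fin n)) (δ : ℝ)
    (Psb Pdb : Matrix (Fin m) (Fin n) ℝ) : Prop :=
  AbsoluteAlternative J Psb Pdb ∧ ∀ i j, δ < |Psb i j - Pdb i j|

/-- The test has Type-I error at most `α` in the absolute bias problem, when the experiment is run
with paper load `lam` and reviewer load `mu`. -/
def ControlsTypeIError (lam mu : ℕ) (α : ℝ) (reject : ∀ {n : ℕ}, TupleSet n → Prop) : Prop :=
  ∀ (n m : ℕ) (J : Finset (Fin n)) (β : Type) (D : Design n m β) (M : ReviewModel n m)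
    (Psb Pdb : Matrix (Fin m) (Fin n) ℝ),
    Even m → D.IsValid lam mu J → M.HasAcceptanceProbabilities Psb Pdb →
    AbsoluteNull Psb Pdb →
    rejectionProbability D M J reject ≤ ENNReal.ofReal α

/-- The test has non-trivial power in the absolute bias problem, when the experiment is run
with paper load `lam` and reviewer load `mu`. -/
def HasNontrivialPower (lam mu : ℕ) (reject : ∀ {n : ℕ}, TupleSet n → Prop) : Prop :=
  ∀ ε : ℝ, 0 < ε → ∀ δ : ℝ, 0 < δ → ∃ n₀ : ℕ,
    ∀ (n m : ℕ) (J : Finset (Fin n)) (β : Type) (D : Design n m β) (M : ReviewModel n m)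
      (Psb Pdb : Matrix (Fin m) (Fin n) ℝ),
      Even m → D.IsValid lam mu J → M.HasAcceptanceProbabilities Psb Pdb →
      n₀ < min J.card Jᶜ.card → AlternativeWithMargin J δ Psb Pdb →
      ENNReal.ofReal (1 - ε) ≤ rejectionProbability D M J reject

end BiasTest

end

noncomputable section

namespace BiasTest

/-! ## Finite products of probability mass functions -/

/-! Condition on the bids and the partial assignment. Every reviewer is in at most one pair,
different reviewers decide independently, and the probability of accepting a paper does not depend
on the other papers assigned. So the completion has no influence, and once the fair coins are
averaged out, the decision pairs `(Y j, X j)` are independent over the papers, each an equal mixture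
over the two roles of its reviewers (`map_pairData`, `law_of_tuples`). Everything after that
concerns a product law.

Under the null, the fair coin makes `(true, false)` and `(false, true)` equally likely for each
paper, even if its two reviewers differ (`pairLaw_symm`). For Disagreement, the weight of an outcome
with given disagreement sets is then invariant under permuting the pooled entries, and a permutation
p-value is valid for such laws (`sum_pValue_le`). For Counting, each difference is symmetric on -1,
0, 1, hence sub-Gaussian, and a two-sided Chernoff bound gives exactly the threshold of the test.

Under the alternative, the mean of `Y j - X j` is the average of the two reviewers' biases, so it
exceeds the margin in the right direction (`pairLaw_sub`). The load constraints and the balanced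
selection keep many papers of both kinds in the pool (`card_inter_pool_ge`), and by Chernoff both
sums of differences are, with high probability, more than half the margin per paper. On that event
both tests reject deterministically: the Counting threshold tends to zero, and the permutation
p-value is bounded by Markov's inequality for the squared statistic, through the second moment of
sampling without replacement (`permutationPValue_le`). -/

theorem sum_pmf_eq_one {α : Type*} [Fintype α] (p : PMF α) : ∑ x, p x = 1 := by
  rw [← tsum_fintype (L := .unconditional _)]
  exact p.tsum_coe

theorem independent_apply {ι α : Type} [Fintype ι] [DecidableEq ι] [Fintype α] (p : ι → PMF α)
    (v : ι → α) : independent p v = ∏ i, p i (v i) := rfl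

theorem sum_prod_eq_prod_sum {ι α R : Type*} [Fintype ι] [DecidableEq ι] [Fintype α]
    [CommSemiring R] (f : ι → α → R) : ∑ v : ι → α, ∏ i, f i (v i) = ∏ i, ∑ x, f i x := by
  have h := Finset.prod_univ_sum (fun _ : ι => (Finset.univ : Finset α)) f
  rw [Fintype.piFinset_univ] at h
  exact h.symm

/-- Distributivity of the product over the sums. It absorbs the coin of each pair into the law of
that pair without losing independence. -/
theorem independent_bind {ι α γ : Type} [Fintype ι] [DecidableEq ι] [Fintype α] [Fintype γ]
    (p : ι → PMF α) (K : ι → α → PMF γ) :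
    ((independent p).bind fun c => independent fun i => K i (c i)) =
      independent fun i => (p i).bind (K i) := by
  ext d
  simp only [PMF.bind_apply, tsum_fintype, independent_apply, ← Finset.prod_mul_distrib]
  exact sum_prod_eq_prod_sum fun i x => p i x * K i x (d i)

theorem uniform_eq_independent {ι : Type} [Fintype ι] [DecidableEq ι] :
    PMF.uniformOfFintype (ι → Bool) = independent fun _ => PMF.uniformOfFintype Bool := by
  ext c
  simp [independent_apply, ENNReal.inv_pow]

theorem pmf_bool_ext {p q : PMF Bool} (h : p true = q true) : p = q := by
  have hp := sum_pmf_eq_one p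
  have hq := sum_pmf_eq_one q
  rw [Fintype.sum_bool] at hp hq
  ext x
  cases x
  · rw [← h, ← hp] at hq
    exact ((ENNReal.add_right_inj (p.apply_ne_top true)).1 hq).symm
  · exact h

theorem bind_eq_of_forall_mem_support {α γ : Type*} (p : PMF α) {f : α → PMF γ} {q : PMF γ}
    (h : ∀ x ∈ p.support, f x = q) : p.bind f = q := by
  have : p.bind f = p.bind fun _ => q := by
    ext y
    simp only [PMF.bind_apply]
    refine tsum_congr fun x => ?_
    by_cases hx : p x = 0
    · simp [hx]
    · rw [h x ((p.mem_support_iff x).2 hx)]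
  rw [this, PMF.bind_const]

theorem bind_toOuterMeasure_le {α γ : Type*} (p : PMF α) (f : α → PMF γ) (s : Set γ) (c : ℝ≥0∞)
    (h : ∀ x ∈ p.support, (f x).toOuterMeasure s ≤ c) : (p.bind f).toOuterMeasure s ≤ c := by
  rw [PMF.toOuterMeasure_bind_apply]
  calc ∑' x, p x * (f x).toOuterMeasure s ≤ ∑' x, p x * c := by
        refine ENNReal.tsum_le_tsum fun x => ?_
        by_cases hx : p x = 0
        · simp [hx]
        · exact mul_le_mul_right (h x ((p.mem_support_iff x).2 hx)) _
    _ = c := by rw [ENNReal.tsum_mul_right, p.tsum_coe, one_mul]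

theorem le_bind_toOuterMeasure {α γ : Type*} (p : PMF α) (f : α → PMF γ) (s : Set γ) (c : ℝ≥0∞)
    (h : ∀ x ∈ p.support, c ≤ (f x).toOuterMeasure s) : c ≤ (p.bind f).toOuterMeasure s := by
  rw [PMF.toOuterMeasure_bind_apply]
  calc c = ∑' x, p x * c := by rw [ENNReal.tsum_mul_right, p.tsum_coe, one_mul]
    _ ≤ _ := by
        refine ENNReal.tsum_le_tsum fun x => ?_
        by_cases hx : p x = 0
        · simp [hx]
        · exact mul_le_mul_right (h x ((p.mem_support_iff x).2 hx)) _

/-! ## The law of the decisions of the pairs -/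

/-- The law of a pair of independent random elements. -/
def pairOf {α γ : Type*} (p : PMF α) (q : PMF γ) : PMF (α × γ) :=
  p.bind fun x => q.map fun y => (x, y)

theorem pairOf_apply {α γ : Type*} (p : PMF α) (q : PMF γ) (z : α × γ) :
    pairOf p q z = p z.1 * q z.2 := by
  classical
  obtain ⟨x, y⟩ := z
  simp only [pairOf, PMF.bind_apply, PMF.map_apply, Prod.mk.injEq]
  rw [tsum_eq_single x (fun x' hx => by simp [Ne.symm hx]),
    tsum_eq_single y (fun y' hy => by simp [Ne.symm hy])]
  simp

variable {n m : ℕ}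

/-- The law of the SB decision of reviewer `i` on paper `j`. -/
def ReviewModel.sbMarginal (M : ReviewModel n m) (i : Fin m) (j : Fin n) : PMF Bool :=
  (M.sb i Finset.univ).map fun v => v j

/-- The law of the DB decision of reviewer `i` on paper `j`. -/
def ReviewModel.dbMarginal (M : ReviewModel n m) (i : Fin m) (j : Fin n) : PMF Bool :=
  (M.db i Finset.univ).map fun v => v j

/-- The law of the SB and the DB decision on paper `j`, given the coin of its pair. -/
def coinLaw (M : ReviewModel n m) (a : PairAssignment n m) (j : Fin n) (c : Bool) :
    PMF (Bool × Bool) :=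
  match a j with
  | some r => if c then pairOf (M.sbMarginal r.1 j) (M.dbMarginal r.2 j)
      else pairOf (M.sbMarginal r.2 j) (M.dbMarginal r.1 j)
  | none => PMF.pure (false, false)

/-- The law of the SB and the DB decision on paper `j`, given the partial assignment. -/
def pairLaw (M : ReviewModel n m) (a : PairAssignment n m) (j : Fin n) : PMF (Bool × Bool) :=
  (PMF.uniformOfFintype Bool).bind (coinLaw M a j)

/-- The SB and the DB decision on each paper of the partial assignment. -/
def pairData (a : PairAssignment n m) (S : Finset (Fin m)) (v : Fin m → Fin n → Bool) (j : Fin n) :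
    Bool × Bool :=
  match a j with
  | some r => (v (if r.1 ∈ S then r.1 else r.2) j, v (if r.1 ∈ S then r.2 else r.1) j)
  | none => (false, false)

/-- The set of tuples with decisions `d`. -/
def tupleOf (J : Finset (Fin n)) (a : PairAssignment n m) (d : Fin n → Bool × Bool) :
    TupleSet n where
  papers := Finset.univ.filter fun j => (a j).isSome
  Y := fun j => (d j).1
  X := fun j => (d j).2
  w := fun j => if j ∈ J then 1 else -1

theorem tuples_eq_tupleOf (J : Finset (Fin n)) (a : PairAssignment n m) (S : Finset (Fin m))
    (v : Fin m → Fin n → Bool) : tuples J a S v = tupleOf J a (pairData a S v) := by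
  simp only [tuples, tupleOf, pairData, TupleSet.mk.injEq, true_and, and_true]
  constructor <;> funext j <;> cases a j <;> rfl

/-- A law on `Bool` is fixed by its mass at `true`, which is the same for all assigned sets
containing `j`. Hence `Finset.univ` in `sbMarginal` is an arbitrary choice, and the completion
cannot affect the law of a paired decision. -/
theorem ReviewModel.HasAcceptanceProbabilities.sb_map {M : ReviewModel n m}
    {Psb Pdb : Matrix (Fin m) (Fin n) ℝ} (h : M.HasAcceptanceProbabilities Psb Pdb) (i : Fin m)
    (P : Finset (Fin n)) (j : Fin n) (hj : j ∈ P) :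
    ((M.sb i P).map fun v => v j) = M.sbMarginal i j :=
  pmf_bool_ext ((h.sb_eq i P j hj).trans (h.sb_eq i _ j (Finset.mem_univ j)).symm)

theorem ReviewModel.HasAcceptanceProbabilities.db_map {M : ReviewModel n m}
    {Psb Pdb : Matrix (Fin m) (Fin n) ℝ} (h : M.HasAcceptanceProbabilities Psb Pdb) (i : Fin m)
    (P : Finset (Fin n)) (j : Fin n) (hj : j ∈ P) :
    ((M.db i P).map fun v => v j) = M.dbMarginal i j :=
  pmf_bool_ext ((h.db_eq i P j hj).trans (h.db_eq i _ j (Finset.mem_univ j)).symm)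

/-- No reviewer belongs to two different pairs. -/
theorem IsPairing.eq_of_mem {P : Finset (Fin n)} {R : Finset (Fin m)} {a : PairAssignment n m}
    (ha : IsPairing P R a) {i : Fin m} {j k : Fin n} {r s : Fin m × Fin m} (hj : a j = some r)
    (hk : a k = some s) (hr : i = r.1 ∨ i = r.2) (hs : i = s.1 ∨ i = s.2) : j = k := by
  have hi : i ∈ R := by
    rcases hr with rfl | rfl
    · exact (ha.two j r hj).2.1
    · exact (ha.two j r hj).2.2
  exact (ha.one i hi).unique ⟨r, hj, hr⟩ ⟨s, hk, hs⟩

/-- The reviewers of paper `j` in the partial assignment. -/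
def pairMembers (a : PairAssignment n m) (j : Fin n) : Finset (Fin m) :=
  match a j with
  | some r => {r.1, r.2}
  | none => ∅

theorem mem_pairMembers {a : PairAssignment n m} {j : Fin n} {i : Fin m} :
    i ∈ pairMembers a j ↔ ∃ r, a j = some r ∧ (i = r.1 ∨ i = r.2) := by
  unfold pairMembers
  cases h : a j <;> simp

/-- A paired reviewer contributes the decision on a single paper, so the event that the data equal
`d` is one condition per reviewer. Its probability is a product over reviewers, which regroups pair
by pair; the dependence among one reviewer's decisions never enters. -/
theorem map_pairData {P : Finset (Fin n)} {R : Finset (Fin m)} {a : PairAssignment n m}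
    (ha : IsPairing P R a) {S : Finset (Fin m)} {c : Fin n → Bool}
    (hS : ∀ j r, a j = some r → ((r.1 ∈ S ↔ c j = true) ∧ (r.2 ∈ S ↔ c j = false)))
    {M : ReviewModel n m} {Psb Pdb : Matrix (Fin m) (Fin n) ℝ}
    (hM : M.HasAcceptanceProbabilities Psb Pdb) {A : Fin n → Finset (Fin m)}
    (hA : ∀ j r, a j = some r → r.1 ∈ A j ∧ r.2 ∈ A j) :
    (M.decisions A S).map (pairData a S) = independent fun j => coinLaw M a j (c j) := by
  classical
  ext d
  set p : Fin m → PMF (Fin n → Bool) := fun i =>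
    if i ∈ S then M.sb i (Finset.univ.filter fun j => i ∈ A j)
    else M.db i (Finset.univ.filter fun j => i ∈ A j) with hp
  have hdec : M.decisions A S = independent p := rfl
  -- The condition that `d` imposes on the decisions of reviewer `i`; it is vacuous outside the
  -- pairs.
  let C : Fin m → (Fin n → Bool) → Prop := fun i x =>
    ∀ j r, a j = some r → (i = r.1 ∨ i = r.2) → x j = if i ∈ S then (d j).1 else (d j).2
  have key : ∀ v, d = pairData a S v ↔
      (∀ j, a j = none → d j = (false, false)) ∧ ∀ i, C i (v i) := by
    intro v
    constructor
    · intro h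
      refine ⟨fun j hj => by rw [h]; simp [pairData, hj], fun i j r hj hi => ?_⟩
      have h1 := (hS j r hj).1
      have h2 := (hS j r hj).2
      rw [h]
      simp only [pairData, hj]
      cases hc : c j <;> rcases hi with rfl | rfl <;> simp_all
    · rintro ⟨h0, h⟩
      funext j
      cases hj : a j with
      | none => simp [pairData, hj, h0 j hj]
      | some r =>
        have h1 := (hS j r hj).1
        have h2 := (hS j r hj).2
        have h3 := h r.1 j r hj (Or.inl rfl)
        have h4 := h r.2 j r hj (Or.inr rfl)
        simp only [pairData, hj]
        cases hc : c j <;> simp_all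
  have hg : ∀ j r, a j = some r → ∀ i, (i = r.1 ∨ i = r.2) →
      (∑ x, if C i x then p i x else 0) =
        if i ∈ S then M.sbMarginal i j (d j).1 else M.dbMarginal i j (d j).2 := by
    intro j r hj i hi
    have hC : ∀ x, C i x ↔ (if i ∈ S then (d j).1 else (d j).2) = x j := by
      intro x
      refine ⟨fun h => (h j r hj hi).symm, fun h k s hk hs => ?_⟩
      obtain rfl := ha.eq_of_mem hj hk hi hs
      exact h.symm
    have hmem : j ∈ Finset.univ.filter fun j => i ∈ A j := by
      rcases hi with rfl | rfl
      · simpa using (hA j r hj).1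
      · simpa using (hA j r hj).2
    simp only [hC]
    by_cases hi' : i ∈ S
    · simp only [hi', if_true, hp]
      rw [← hM.sb_map i _ j hmem, PMF.map_apply, tsum_fintype]
      exact Finset.sum_congr rfl fun x _ => by congr
    · simp only [hi', if_false, hp]
      rw [← hM.db_map i _ j hmem, PMF.map_apply, tsum_fintype]
      exact Finset.sum_congr rfl fun x _ => by congr
  rw [hdec, PMF.map_apply, tsum_fintype, independent_apply]
  simp only [key]
  by_cases h0 : ∀ j, a j = none → d j = (false, false)
  · have e1 : ∀ v : Fin m → Fin n → Bool,
        (if (∀ j, a j = none → d j = (false, false)) ∧ ∀ i, C i (v i) then independent p v else 0)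
          = ∏ i, if C i (v i) then p i (v i) else 0 := by
      intro v
      by_cases h : ∀ i, C i (v i)
      · rw [if_pos ⟨h0, h⟩, independent_apply]
        exact Finset.prod_congr rfl fun i _ => (if_pos (h i)).symm
      · rw [if_neg fun h' => h h'.2]
        push Not at h
        obtain ⟨i, hi⟩ := h
        exact (Finset.prod_eq_zero (Finset.mem_univ i) (if_neg hi)).symm
    rw [Finset.sum_congr rfl fun v _ => e1 v,
      sum_prod_eq_prod_sum (fun i x => if C i x then p i x else 0)]
    -- Reviewers outside the pairs contribute a factor 1; the remaining ones split into disjoint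
    -- pairs.
    have e2 : ∏ i, (∑ x, if C i x then p i x else 0) =
        ∏ i ∈ Finset.univ.biUnion (pairMembers a), (∑ x, if C i x then p i x else 0) := by
      refine (Finset.prod_subset (Finset.subset_univ _) fun i _ hi => ?_).symm
      have hC : ∀ x, C i x := fun x j r hj hr =>
        absurd (Finset.mem_biUnion.2 ⟨j, Finset.mem_univ j, mem_pairMembers.2 ⟨r, hj, hr⟩⟩) hi
      simp only [hC, if_true]
      exact sum_pmf_eq_one _
    rw [e2, Finset.prod_biUnion]
    · refine Finset.prod_congr rfl fun j _ => ?_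
      cases hj : a j with
      | none => simp [pairMembers, coinLaw, hj, h0 j hj]
      | some r =>
        have hne := (ha.two j r hj).1
        have h1 := (hS j r hj).1
        have h2 := (hS j r hj).2
        simp only [pairMembers, coinLaw, hj]
        rw [Finset.prod_pair hne, hg j r hj _ (Or.inl rfl), hg j r hj _ (Or.inr rfl)]
        cases hc : c j <;> simp_all [pairOf_apply, mul_comm]
    · intro j _ k _ hjk
      refine Finset.disjoint_left.2 fun i hi hi' => hjk ?_
      obtain ⟨r, hr, hir⟩ := mem_pairMembers.1 hi
      obtain ⟨s, hs, his⟩ := mem_pairMembers.1 hi'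
      exact ha.eq_of_mem hr hs hir his
  -- If `d` violates the default `(false, false)` at a paper without a pair, both sides vanish.
  · rw [Finset.sum_eq_zero fun v _ => if_neg fun h => h0 h.1]
    push Not at h0
    obtain ⟨j, hj, hd⟩ := h0
    refine (Finset.prod_eq_zero (Finset.mem_univ j) ?_).symm
    simp [coinLaw, hj, hd]

/-- The random half `H` avoids all paired reviewers, and no other pair's coin can reach a reviewer
of this pair, so only the coin of `j` matters. -/
theorem mem_allocation_iff {P : Finset (Fin n)} {R : Finset (Fin m)} {a : PairAssignment n m}
    (ha : IsPairing P R a) (c : Fin n → Bool) {H : Finset (Fin m)} (hH : H ⊆ (usedReviewers a)ᶜ)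
    (j : Fin n) (r : Fin m × Fin m) (hj : a j = some r) :
    (r.1 ∈ coinSB a c ∪ H ↔ c j = true) ∧ (r.2 ∈ coinSB a c ∪ H ↔ c j = false) := by
  have hne := (ha.two j r hj).1
  have hn : ∀ i, (i = r.1 ∨ i = r.2) → i ∉ H := fun i hi hiH => by
    have := hH hiH
    rw [Finset.mem_compl] at this
    exact this (by simpa [usedReviewers] using ⟨j, r.1, r.2, hj, hi⟩)
  have hc : ∀ i, (i = r.1 ∨ i = r.2) → (i ∈ coinSB a c ∪ H ↔ i = if c j then r.1 else r.2) := by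
    intro i hi
    rw [Finset.mem_union, or_iff_left (hn i hi), coinSB, Finset.mem_filter]
    refine ⟨?_, fun h => ⟨Finset.mem_univ _, j, r, hj, h⟩⟩
    rintro ⟨-, k, s, hk, his⟩
    have his' : i = s.1 ∨ i = s.2 := by
      split_ifs at his
      · exact Or.inl his
      · exact Or.inr his
    obtain rfl := ha.eq_of_mem hj hk hi his'
    rw [hj, Option.some.injEq] at hk
    rw [hk]
    exact his
  rw [hc _ (Or.inl rfl), hc _ (Or.inr rfl)]
  cases c j <;> simp [hne, Ne.symm hne]

/-- Given the partial assignment, the pairs of decisions on the papers are independent. -/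
theorem law_of_tuples {β : Type} {D : Design n m β} {M : ReviewModel n m} {lam mu : ℕ}
    {J : Finset (Fin n)} {Psb Pdb : Matrix (Fin m) (Fin n) ℝ} (hD : D.IsValid lam mu J)
    (hM : M.HasAcceptanceProbabilities Psb Pdb) {b : β} (hb : b ∈ D.bidLaw.support)
    {a : PairAssignment n m} (ha : a ∈ (D.pairing b).support) {P : Finset (Fin n)}
    {R : Finset (Fin m)} (hP : IsPairing P R a) :
    ((allocate a).bind fun S => (D.complete b a S).bind fun A =>
      (M.decisions A S).map fun v => tuples J a S v) =
      (independent (pairLaw M a)).map (tupleOf J a) := by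
  have hstep : ∀ (c : Fin n → Bool) (H : Finset (Fin m)), H ⊆ (usedReviewers a)ᶜ →
      coinSB a c ∪ H ∈ (allocate a).support →
      ((D.complete b a (coinSB a c ∪ H)).bind fun A =>
        (M.decisions A (coinSB a c ∪ H)).map fun v => tuples J a (coinSB a c ∪ H) v) =
      (independent fun j => coinLaw M a j (c j)).map (tupleOf J a) := by
    intro c H hH hS
    refine bind_eq_of_forall_mem_support _ fun A hA => ?_
    have hcompl := hD.complete b hb a ha _ hS A hA
    rw [← map_pairData hP (mem_allocation_iff hP c hH) hM hcompl.extends_pairs, PMF.map_comp]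
    congr 1
    funext v
    exact tuples_eq_tupleOf J a _ v
  have hmem : ∀ c H, H ∈ Finset.powersetCard ((usedReviewers a)ᶜ.card / 2) (usedReviewers a)ᶜ →
      coinSB a c ∪ H ∈ (allocate a).support := by
    intro c H hH
    simp only [allocate, PMF.mem_support_bind_iff, PMF.mem_support_map_iff]
    exact ⟨c, by simp, H, (PMF.mem_support_uniformOfFinset_iff _ _ ).2 hH, rfl⟩
  rw [show independent (pairLaw M a) = _ from (independent_bind _ _).symm,
    ← uniform_eq_independent, PMF.map_bind, allocate, PMF.bind_bind]
  congr 1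
  funext c
  rw [PMF.bind_map]
  refine bind_eq_of_forall_mem_support _ fun H hH => ?_
  rw [PMF.mem_support_uniformOfFinset_iff] at hH
  exact hstep c H (Finset.mem_powersetCard.1 hH).1 (hmem c H hH)

/-! ## The permutation test -/

/-- Take an element of the filtered set with least `T`: the whole set lies in its upper set, which
has at most `c` elements. -/
theorem card_filter_card_le {G : Type*} [Fintype G] [DecidableEq G] (T : G → ℝ) {c : ℝ}
    (hc : 0 ≤ c) :
    ((Finset.univ.filter fun σ =>
      ((Finset.univ.filter fun σ' => T σ ≤ T σ').card : ℝ) ≤ c).card : ℝ) ≤ c := by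
  set B := Finset.univ.filter fun σ =>
      ((Finset.univ.filter fun σ' => T σ ≤ T σ').card : ℝ) ≤ c with hB
  rcases B.eq_empty_or_nonempty with h | h
  · simpa [h] using hc
  · obtain ⟨σ, hσ, hmin⟩ := B.exists_min_image T h
    have h1 := (Finset.mem_filter.1 hσ).2
    refine le_trans ?_ h1
    exact_mod_cast Finset.card_le_card fun σ' hσ' => by simpa using hmin σ' hσ'

/-- Left multiplication by `σ` is a bijection of the group, so the p-value of rearranged data is the
normalized upper rank of `σ` among all rearrangements of the original data. -/
theorem permutationPValue_comp (U V : Finset (Fin n)) (f : Fin n → ℝ)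
    (σ : Equiv.Perm {j : Fin n // j ∈ U ∪ V}) :
    permutationPValue U V (f ∘ Equiv.Perm.ofSubtype σ) =
      ((Finset.univ.filter fun σ' : Equiv.Perm {j : Fin n // j ∈ U ∪ V} =>
        |meanDiff U V (f ∘ Equiv.Perm.ofSubtype σ)| ≤
          |meanDiff U V (f ∘ Equiv.Perm.ofSubtype σ')|).card : ℝ) /
      (Fintype.card (Equiv.Perm {j : Fin n // j ∈ U ∪ V}) : ℝ) := by
  unfold permutationPValue
  congr 2
  refine Finset.card_equiv (Equiv.mulLeft σ) fun σ' => ?_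
  simp [Function.comp_assoc]

/-- Among the rearrangements of given data, at most a proportion `α` has p-value at most `α`. -/
theorem card_permutationPValue_le (U V : Finset (Fin n)) (f : Fin n → ℝ) {α : ℝ} (hα : 0 ≤ α) :
    ((Finset.univ.filter fun σ : Equiv.Perm {j : Fin n // j ∈ U ∪ V} =>
      permutationPValue U V (f ∘ Equiv.Perm.ofSubtype σ) ≤ α).card : ℝ) ≤
      α * (Fintype.card (Equiv.Perm {j : Fin n // j ∈ U ∪ V}) : ℝ) := by
  have hpos : (0 : ℝ) < (Fintype.card (Equiv.Perm {j : Fin n // j ∈ U ∪ V}) : ℝ) := by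
    exact_mod_cast Fintype.card_pos
  simp only [permutationPValue_comp, div_le_iff₀ hpos]
  exact card_filter_card_le _ (mul_nonneg hα hpos.le)

/-- Sampling without replacement is negatively correlated. By a transposition, the sum is the same
for every `j ≠ i`; since `g` has total zero, these sums add up to minus a sum of squares. -/
theorem sum_perm_mul_nonpos {W : Type*} [Fintype W] [DecidableEq W] (g : W → ℝ)
    (hg : ∑ k, g k = 0) {i j : W} (hij : i ≠ j) :
    ∑ σ : Equiv.Perm W, g (σ i) * g (σ j) ≤ 0 := by
  have hswap : ∀ k ∈ Finset.univ.erase i,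
      ∑ σ : Equiv.Perm W, g (σ i) * g (σ k) = ∑ σ : Equiv.Perm W, g (σ i) * g (σ j) := by
    intro k hk
    refine Fintype.sum_equiv (Equiv.mulRight (Equiv.swap j k)) _ _ fun σ => ?_
    have hki : i ≠ k := (Finset.ne_of_mem_erase hk).symm
    simp [Equiv.swap_apply_of_ne_of_ne hij hki]
  have hsum : ∑ k ∈ Finset.univ.erase i, ∑ σ : Equiv.Perm W, g (σ i) * g (σ k) =
      -∑ σ : Equiv.Perm W, g (σ i) ^ 2 := by
    rw [Finset.sum_comm, ← Finset.sum_neg_distrib]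
    refine Finset.sum_congr rfl fun σ _ => ?_
    have h1 := Finset.add_sum_erase Finset.univ (fun k => g (σ k)) (Finset.mem_univ i)
    rw [Equiv.sum_comp σ g, hg] at h1
    rw [← Finset.mul_sum, eq_neg_of_add_eq_zero_right h1]
    ring
  rw [Finset.sum_congr rfl hswap, Finset.sum_const, nsmul_eq_mul] at hsum
  have hcard : (0 : ℝ) < ((Finset.univ.erase i).card : ℝ) := by
    exact_mod_cast Finset.card_pos.2 ⟨j, Finset.mem_erase.2 ⟨hij.symm, Finset.mem_univ j⟩⟩
  have hsq : 0 ≤ ∑ σ : Equiv.Perm W, g (σ i) ^ 2 := Finset.sum_nonneg fun _ _ => sq_nonneg _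
  by_contra! hpos
  have := mul_pos hcard hpos
  linarith

/-- Second moment of a sum sampled without replacement. -/
theorem sum_perm_sq_le {W : Type*} [Fintype W] [DecidableEq W] (g : W → ℝ)
    (hg : ∑ k, g k = 0) (hb : ∀ k, g k ^ 2 ≤ 1) (U : Finset W) :
    ∑ σ : Equiv.Perm W, (∑ j ∈ U, g (σ j)) ^ 2 ≤ U.card * Fintype.card (Equiv.Perm W) := by
  have h1 : ∑ σ : Equiv.Perm W, (∑ j ∈ U, g (σ j)) ^ 2 =
      ∑ i ∈ U, ∑ j ∈ U, ∑ σ : Equiv.Perm W, g (σ i) * g (σ j) := by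
    simp only [sq, Finset.sum_mul_sum]
    rw [Finset.sum_comm]
    exact Finset.sum_congr rfl fun i _ => Finset.sum_comm
  rw [h1, ← nsmul_eq_mul, ← Finset.sum_const]
  refine Finset.sum_le_sum fun i hi => ?_
  rw [← Finset.add_sum_erase U _ hi]
  have h2 : ∑ σ : Equiv.Perm W, g (σ i) * g (σ i) ≤ (Fintype.card (Equiv.Perm W) : ℝ) := by
    calc ∑ σ : Equiv.Perm W, g (σ i) * g (σ i) ≤ ∑ _σ : Equiv.Perm W, (1 : ℝ) :=
          Finset.sum_le_sum fun σ _ => by simpa [sq] using hb (σ i)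
      _ = _ := by simp
  have h3 : ∑ j ∈ U.erase i, ∑ σ : Equiv.Perm W, g (σ i) * g (σ j) ≤ 0 :=
    Finset.sum_nonpos fun j hj => sum_perm_mul_nonpos g hg (Finset.ne_of_mem_erase hj).symm
  linarith

theorem sum_comp_ofSubtype {p : Fin n → Prop} [DecidablePred p] (U : Finset (Fin n))
    (hU : ∀ j ∈ U, p j) (f : Fin n → ℝ) (σ : Equiv.Perm {j // p j}) :
    ∑ j ∈ U, f (Equiv.Perm.ofSubtype σ j) = ∑ k ∈ U.subtype p, f (σ k) := by
  rw [← Finset.sum_subtype_of_mem (fun j => f (Equiv.Perm.ofSubtype σ j)) hU]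
  simp

theorem meanDiff_sub_const {U V : Finset (Fin n)} (hU : U.Nonempty) (hV : V.Nonempty)
    (f : Fin n → ℝ) (c : ℝ) : meanDiff U V (fun j => f j - c) = meanDiff U V f := by
  have h1 : (U.card : ℝ) ≠ 0 := by exact_mod_cast hU.card_pos.ne'
  have h2 : (V.card : ℝ) ≠ 0 := by exact_mod_cast hV.card_pos.ne'
  simp only [meanDiff, Finset.sum_sub_distrib, Finset.sum_const, nsmul_eq_mul]
  field_simp
  ring

/-- If the arrays have far apart means, then the p-value is small. -/
theorem permutationPValue_le {U V : Finset (Fin n)} (hU : U.Nonempty) (hV : V.Nonempty)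
    (f : Fin n → ℝ) (hf : ∀ j, f j ∈ Set.Icc (0 : ℝ) 1) {t : ℝ} (ht : 0 < t)
    (htf : t ≤ |meanDiff U V f|) :
    permutationPValue U V f ≤ 2 * ((U.card : ℝ)⁻¹ + (V.card : ℝ)⁻¹) / t ^ 2 := by
  set W := {j : Fin n // j ∈ U ∪ V}
  have hUpos : (0 : ℝ) < U.card := by exact_mod_cast hU.card_pos
  have hVpos : (0 : ℝ) < V.card := by exact_mod_cast hV.card_pos
  have hGpos : (0 : ℝ) < (Fintype.card (Equiv.Perm W) : ℝ) := by exact_mod_cast Fintype.card_pos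
  have hWpos : (0 : ℝ) < (Fintype.card W : ℝ) := by
    obtain ⟨j, hj⟩ := hU
    have : Nonempty W := ⟨⟨j, Finset.mem_union_left _ hj⟩⟩
    exact_mod_cast Fintype.card_pos
  -- Centring at the pooled mean leaves `meanDiff` unchanged and gives the zero total that
  -- `sum_perm_sq_le` needs.
  set c : ℝ := (∑ k : W, f k) / Fintype.card W with hc
  have hc0 : 0 ≤ c := div_nonneg (Finset.sum_nonneg fun k _ => (hf k).1) hWpos.le
  have hc1 : c ≤ 1 := by
    rw [hc, div_le_one hWpos]
    calc ∑ k : W, f k ≤ ∑ _k : W, (1 : ℝ) := Finset.sum_le_sum fun k _ => (hf k).2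
      _ = _ := by simp
  set g : Fin n → ℝ := fun j => f j - c with hg
  have hg0 : ∑ k : W, g k = 0 := by
    simp only [hg, Finset.sum_sub_distrib, Finset.sum_const, nsmul_eq_mul, Finset.card_univ, hc]
    field_simp
    ring
  have hgb : ∀ j, g j ^ 2 ≤ 1 := fun j => by
    have := hf j
    rw [sq_le_one_iff_abs_le_one, abs_le]
    constructor <;> simp only [hg] <;> linarith [this.1, this.2]
  have hmean : ∀ σ : Equiv.Perm W, meanDiff U V (f ∘ Equiv.Perm.ofSubtype σ) =
      (∑ k ∈ U.subtype (· ∈ U ∪ V), g (σ k)) / U.card -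
        (∑ k ∈ V.subtype (· ∈ U ∪ V), g (σ k)) / V.card := by
    intro σ
    rw [← meanDiff_sub_const hU hV _ c,
      ← sum_comp_ofSubtype U (fun j hj => Finset.mem_union_left _ hj) g σ,
      ← sum_comp_ofSubtype V (fun j hj => Finset.mem_union_right _ hj) g σ]
    rfl
  have hsub : ∀ S : Finset (Fin n), S ⊆ U ∪ V → ((S.subtype (· ∈ U ∪ V)).card : ℝ) = S.card := by
    intro S hS
    rw [Finset.card_subtype, Finset.filter_true_of_mem hS]
  have hmU := sum_perm_sq_le (fun k : W => g k) hg0 (fun k => hgb k) (U.subtype (· ∈ U ∪ V))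
  have hmV := sum_perm_sq_le (fun k : W => g k) hg0 (fun k => hgb k) (V.subtype (· ∈ U ∪ V))
  rw [hsub U Finset.subset_union_left] at hmU
  rw [hsub V Finset.subset_union_right] at hmV
  have hsq : ∑ σ : Equiv.Perm W, meanDiff U V (f ∘ Equiv.Perm.ofSubtype σ) ^ 2 ≤
      2 * ((U.card : ℝ)⁻¹ + (V.card : ℝ)⁻¹) * Fintype.card (Equiv.Perm W) := by
    calc ∑ σ : Equiv.Perm W, meanDiff U V (f ∘ Equiv.Perm.ofSubtype σ) ^ 2
        ≤ ∑ σ : Equiv.Perm W, (2 * ((U.card : ℝ)⁻¹ ^ 2 *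
            (∑ k ∈ U.subtype (· ∈ U ∪ V), g (σ k)) ^ 2) + 2 * ((V.card : ℝ)⁻¹ ^ 2 *
            (∑ k ∈ V.subtype (· ∈ U ∪ V), g (σ k)) ^ 2)) := by
          refine Finset.sum_le_sum fun σ _ => ?_
          rw [hmean, div_eq_inv_mul, div_eq_inv_mul, ← mul_pow, ← mul_pow]
          generalize (U.card : ℝ)⁻¹ * _ = x
          generalize (V.card : ℝ)⁻¹ * _ = y
          nlinarith [sq_nonneg (x + y)]
      _ ≤ 2 * ((U.card : ℝ)⁻¹ ^ 2 * (U.card * Fintype.card (Equiv.Perm W))) +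
          2 * ((V.card : ℝ)⁻¹ ^ 2 * (V.card * Fintype.card (Equiv.Perm W))) := by
          rw [Finset.sum_add_distrib, ← Finset.mul_sum, ← Finset.mul_sum, ← Finset.mul_sum,
            ← Finset.mul_sum]
          gcongr
      _ = _ := by field_simp
  -- Markov's inequality for the squared statistic: each counted permutation contributes at least `t
  -- ^ 2` to the second moment.
  rw [permutationPValue, div_le_div_iff₀ hGpos (by positivity)]
  refine le_trans ?_ hsq
  rw [← nsmul_eq_mul, ← Finset.sum_const]
  refine le_trans (Finset.sum_le_sum fun σ hσ => ?_)
    (Finset.sum_le_univ_sum_of_nonneg fun σ => sq_nonneg _)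
  rw [← sq_abs (meanDiff U V (f ∘ _))]
  have := (Finset.mem_filter.1 hσ).2
  gcongr
  exact htf.trans this

/-! ## Concentration for independent variables -/

theorem independent_toOuterMeasure {ι κ : Type} [Fintype ι] [DecidableEq ι] [Fintype κ]
    (q : ι → PMF κ) (s : Set (ι → κ)) [DecidablePred (· ∈ s)] :
    (independent q).toOuterMeasure s =
      ENNReal.ofReal (∑ d, if d ∈ s then ∏ j, (q j (d j)).toReal else 0) := by
  rw [PMF.toOuterMeasure_apply_fintype, ENNReal.ofReal_sum_of_nonneg]
  · refine Finset.sum_congr rfl fun d _ => ?_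
    by_cases hd : d ∈ s
    · rw [Set.indicator_of_mem hd, if_pos hd, independent_apply, ← ENNReal.toReal_prod,
        ENNReal.ofReal_toReal]
      exact ENNReal.prod_ne_top fun j _ => (q j).apply_ne_top _
    · simp [hd]
  · intro d _
    split_ifs
    · exact Finset.prod_nonneg fun _ _ => ENNReal.toReal_nonneg
    · exact le_rfl

/-- Exponential Markov inequality; the exponential scale is absorbed into `g`, and independence
factors the moment generating function. -/
theorem chernoff {ι κ : Type} [Fintype ι] [DecidableEq ι] [Fintype κ] (q : ι → PMF κ)
    (g : ι → κ → ℝ) (b : ι → ℝ)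
    (hb : ∀ j, ∑ x, (q j x).toReal * Real.exp (g j x) ≤ Real.exp (b j)) (t : ℝ) :
    (independent q).toOuterMeasure {d | t ≤ ∑ j, g j (d j)} ≤
      ENNReal.ofReal (Real.exp (∑ j, b j - t)) := by
  classical
  rw [independent_toOuterMeasure]
  refine ENNReal.ofReal_le_ofReal ?_
  calc ∑ d : ι → κ, (if d ∈ {d : ι → κ | t ≤ ∑ j, g j (d j)} then ∏ j, (q j (d j)).toReal else 0)
      ≤ ∑ d : ι → κ, Real.exp (-t) * ∏ j, (q j (d j)).toReal * Real.exp (g j (d j)) := by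
        refine Finset.sum_le_sum fun d _ => ?_
        have hnn : 0 ≤ ∏ j, (q j (d j)).toReal :=
          Finset.prod_nonneg fun _ _ => ENNReal.toReal_nonneg
        rw [Finset.prod_mul_distrib, ← Real.exp_sum, mul_left_comm, ← Real.exp_add]
        split_ifs with h
        · exact le_mul_of_one_le_right hnn (Real.one_le_exp (by simpa using h))
        · positivity
    _ = Real.exp (-t) * ∏ j, ∑ x, (q j x).toReal * Real.exp (g j x) := by
        rw [← Finset.mul_sum, sum_prod_eq_prod_sum fun j x => (q j x).toReal * Real.exp (g j x)]
    _ ≤ Real.exp (-t) * ∏ j, Real.exp (b j) := by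
        gcongr
        exact hb _
    _ = _ := by rw [← Real.exp_sum, ← Real.exp_add]; ring_nf

/-! ## The law of the decisions of one pair -/

/-- The probability of the decision `x` if acceptance has probability `p`. -/
def bern (p : ℝ) (x : Bool) : ℝ := if x then p else 1 - p

theorem toReal_bool {q : PMF Bool} {p : ℝ} (hp : p ∈ Set.Icc (0 : ℝ) 1)
    (h : q true = ENNReal.ofReal p) (x : Bool) : (q x).toReal = bern p x := by
  have h1 : (q true).toReal = p := by rw [h, ENNReal.toReal_ofReal hp.1]
  have h2 := congrArg ENNReal.toReal (sum_pmf_eq_one q)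
  rw [Fintype.sum_bool, ENNReal.toReal_add (q.apply_ne_top _) (q.apply_ne_top _), h1,
    ENNReal.toReal_one] at h2
  cases x
  · simp only [bern, Bool.false_eq_true, if_false]
    linarith
  · simpa [bern] using h1

theorem pairLaw_toReal {M : ReviewModel n m} {Psb Pdb : Matrix (Fin m) (Fin n) ℝ}
    (hM : M.HasAcceptanceProbabilities Psb Pdb) {a : PairAssignment n m} {j : Fin n}
    {r : Fin m × Fin m} (hj : a j = some r) (z : Bool × Bool) :
    (pairLaw M a j z).toReal = (bern (Psb r.1 j) z.1 * bern (Pdb r.2 j) z.2 +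
      bern (Psb r.2 j) z.1 * bern (Pdb r.1 j) z.2) / 2 := by
  have hs : ∀ i x, (M.sbMarginal i j x).toReal = bern (Psb i j) x := fun i x =>
    toReal_bool (hM.sb_mem i j) (hM.sb_eq i _ j (Finset.mem_univ j)) x
  have hd : ∀ i x, (M.dbMarginal i j x).toReal = bern (Pdb i j) x := fun i x =>
    toReal_bool (hM.db_mem i j) (hM.db_eq i _ j (Finset.mem_univ j)) x
  have hne : ∀ i k, M.sbMarginal i j z.1 * M.dbMarginal k j z.2 ≠ ⊤ := fun i k =>
    ENNReal.mul_ne_top (PMF.apply_ne_top _ _) (PMF.apply_ne_top _ _)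
  simp only [pairLaw, PMF.bind_apply, tsum_fintype, Fintype.sum_bool, coinLaw, hj, if_true,
    Bool.false_eq_true, if_false, pairOf_apply, PMF.uniformOfFintype_apply]
  rw [ENNReal.toReal_add (ENNReal.mul_ne_top (by simp) (hne _ _))
    (ENNReal.mul_ne_top (by simp) (hne _ _))]
  simp only [ENNReal.toReal_mul, hs, hd, Fintype.card_bool, ENNReal.toReal_inv]
  norm_num
  ring

theorem pairLaw_none (M : ReviewModel n m) {a : PairAssignment n m} {j : Fin n}
    (hj : a j = none) : pairLaw M a j = PMF.pure (false, false) :=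
  bind_eq_of_forall_mem_support _ fun c _ => by simp [coinLaw, hj]

/-- Under the null, exchanging the SB and DB decisions has the same effect as flipping the coin, and
the coin is fair. -/
theorem pairLaw_symm {M : ReviewModel n m} {Psb Pdb : Matrix (Fin m) (Fin n) ℝ}
    (hM : M.HasAcceptanceProbabilities Psb Pdb) (h0 : AbsoluteNull Psb Pdb)
    (a : PairAssignment n m) (j : Fin n) :
    (pairLaw M a j (true, false)).toReal = (pairLaw M a j (false, true)).toReal := by
  cases hj : a j with
  | none => simp [pairLaw_none M hj]
  | some r =>
    rw [pairLaw_toReal hM hj, pairLaw_toReal hM hj]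
    simp only [bern, h0 r.1 j, h0 r.2 j, if_true, Bool.false_eq_true, if_false]
    ring

/-- The left side is the mean of the SB decision minus that of the DB decision, so the products of
acceptance probabilities cancel. -/
theorem pairLaw_sub {M : ReviewModel n m} {Psb Pdb : Matrix (Fin m) (Fin n) ℝ}
    (hM : M.HasAcceptanceProbabilities Psb Pdb)
    {a : PairAssignment n m} {j : Fin n} {r : Fin m × Fin m} (hj : a j = some r) :
    (pairLaw M a j (true, false)).toReal - (pairLaw M a j (false, true)).toReal =
      ((Psb r.1 j - Pdb r.1 j) + (Psb r.2 j - Pdb r.2 j)) / 2 := by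
  rw [pairLaw_toReal hM hj, pairLaw_toReal hM hj]
  simp only [bern, if_true, Bool.false_eq_true, if_false]
  ring

/-- The difference of the two decisions. -/
def diff (z : Bool × Bool) : ℝ := num z.1 - num z.2

theorem sum_toReal_pair (q : PMF (Bool × Bool)) : (q (true, true)).toReal +
    (q (true, false)).toReal + (q (false, true)).toReal + (q (false, false)).toReal = 1 := by
  have h := congrArg ENNReal.toReal (sum_pmf_eq_one q)
  rw [ENNReal.toReal_sum fun x _ => q.apply_ne_top x, Fintype.sum_prod_type] at h
  simp only [Fintype.sum_bool, ENNReal.toReal_one] at h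
  linarith

theorem sum_exp_diff (q : PMF (Bool × Bool)) (s : ℝ) :
    ∑ x, (q x).toReal * Real.exp (s * diff x) =
      1 + (q (true, false)).toReal * (Real.exp s - 1) +
        (q (false, true)).toReal * (Real.exp (-s) - 1) := by
  have h := sum_toReal_pair q
  rw [Fintype.sum_prod_type]
  simp only [Fintype.sum_bool, diff, num, if_true, Bool.false_eq_true, if_false, sub_self, mul_zero,
    Real.exp_zero, sub_zero, zero_sub, mul_one, mul_neg]
  linear_combination h

/-- With `p` the common mass, the left side is `1 + 2 * p * (cosh s - 1)`, and `2 * p ≤ 1` bounds it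
by `cosh s`. -/
theorem sum_exp_diff_le_of_symm {q : PMF (Bool × Bool)}
    (hq : (q (true, false)).toReal = (q (false, true)).toReal) (s : ℝ) :
    ∑ x, (q x).toReal * Real.exp (s * diff x) ≤ Real.exp (s ^ 2 / 2) := by
  refine le_trans ?_ (Real.cosh_le_exp_half_sq s)
  have h := sum_toReal_pair q
  have h1 : 0 ≤ (q (true, true)).toReal := ENNReal.toReal_nonneg
  have h2 : 0 ≤ (q (false, false)).toReal := ENNReal.toReal_nonneg
  have h3 := Real.one_le_cosh s
  have h4 : Real.exp s + Real.exp (-s) = 2 * Real.cosh s := by rw [Real.cosh_eq]; ring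
  rw [sum_exp_diff, ← hq]
  have h5 : 2 * (q (true, false)).toReal ≤ 1 := by linarith
  nlinarith

/-- With `exp s ≤ 1 + s + s ^ 2` at `s = -(δ / 4) * e`, the linear term gains `δ ^ 2 / 4` and the
quadratic one costs at most `δ ^ 2 / 16`. -/
theorem sum_exp_diff_le_of_gap {q : PMF (Bool × Bool)} {e δ : ℝ} (he : e = 1 ∨ e = -1)
    (hδ : 0 < δ)
    (hq : δ ≤ e * ((q (true, false)).toReal - (q (false, true)).toReal)) :
    ∑ x, (q x).toReal * Real.exp (-(δ / 4) * e * diff x) ≤ Real.exp (-(3 * δ ^ 2 / 16)) := by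
  have h := sum_toReal_pair q
  have h1 : 0 ≤ (q (true, true)).toReal := ENNReal.toReal_nonneg
  have h2 : 0 ≤ (q (false, false)).toReal := ENNReal.toReal_nonneg
  have h3 : 0 ≤ (q (true, false)).toReal := ENNReal.toReal_nonneg
  have h4 : 0 ≤ (q (false, true)).toReal := ENNReal.toReal_nonneg
  -- A difference of two probabilities is at most 1; this gives `|s| ≤ 1` for the expansion of
  -- `exp`.
  have hδ1 : δ ≤ 1 := by rcases he with rfl | rfl <;> linarith
  set s := -(δ / 4) * e with hs
  have hs1 : |s| ≤ 1 := by
    rcases he with rfl | rfl <;> rw [hs, abs_le] <;> constructor <;> linarith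
  have hs2 : s ^ 2 = δ ^ 2 / 16 := by
    rcases he with rfl | rfl <;> rw [hs] <;> ring
  have e1 := (abs_le.1 (Real.abs_exp_sub_one_sub_id_le hs1)).2
  have e2 := (abs_le.1 (Real.abs_exp_sub_one_sub_id_le (x := -s) (by rwa [abs_neg]))).2
  rw [neg_sq] at e2
  rw [sum_exp_diff]
  refine le_trans ?_ (Real.add_one_le_exp _)
  have e3 := mul_le_mul_of_nonneg_left e1 h3
  have e4 := mul_le_mul_of_nonneg_left e2 h4
  have e5 : ((q (true, false)).toReal + (q (false, true)).toReal) * s ^ 2 ≤ 1 * s ^ 2 := by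
    gcongr
    linarith
  have e6 : s * ((q (true, false)).toReal - (q (false, true)).toReal) ≤ -(δ ^ 2 / 4) := by
    rw [hs]
    nlinarith
  nlinarith

/-! ## Type-I error -/

/-- The index sets of the arrays of the Disagreement test. -/
def disagreements (J : Finset (Fin n)) (a : PairAssignment n m) (d : Fin n → Bool × Bool) :
    Finset (Fin n) × Finset (Fin n) :=
  ((tupleOf J a d).papers.filter fun j => (d j).1 ≠ (d j).2 ∧ (tupleOf J a d).w j = 1,
    (tupleOf J a d).papers.filter fun j => (d j).1 ≠ (d j).2 ∧ (tupleOf J a d).w j = -1)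

/-- Permuting the decision pairs within `U ∪ V` preserves the disagreement sets. It also preserves
the weight: at each paper both kinds of disagreement have equal mass, though this mass may vary with
the paper. Averaging over all permutations reduces the bound to `card_permutationPValue_le`. -/
theorem sum_pValue_le (q : Fin n → PMF (Bool × Bool))
    (hq : ∀ j, (q j (true, false)).toReal = (q j (false, true)).toReal)
    (J : Finset (Fin n)) (a : PairAssignment n m) {α : ℝ} (hα : 0 ≤ α)
    (U V : Finset (Fin n)) :
    (∑ d with disagreements J a d = (U, V),
      if permutationPValue U V (fun j => num (d j).1) ≤ α then ∏ j, (q j (d j)).toReal else 0) ≤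
    α * ∑ d with disagreements J a d = (U, V), ∏ j, (q j (d j)).toReal := by
  classical
  set G := Equiv.Perm {j : Fin n // j ∈ U ∪ V}
  have hGpos : (0 : ℝ) < (Fintype.card G : ℝ) := by exact_mod_cast Fintype.card_pos
  set C : Finset (Fin n → Bool × Bool) := Finset.univ.filter fun d => disagreements J a d = (U, V)
    with hC
  have hne : ∀ d ∈ C, ∀ j ∈ U ∪ V, (d j).1 ≠ (d j).2 := by
    intro d hd j hj
    have h := (Finset.mem_filter.1 hd).2
    simp only [disagreements, Prod.mk.injEq] at h
    rw [← h.1, ← h.2] at hj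
    simp only [Finset.mem_union, Finset.mem_filter] at hj
    tauto
  have hmemG : ∀ (σ : G) (j : Fin n), j ∈ U ∪ V → Equiv.Perm.ofSubtype σ j ∈ U ∪ V := by
    intro σ j hj
    rw [Equiv.Perm.ofSubtype_apply_of_mem σ hj]
    exact (σ ⟨j, hj⟩).2
  have hfix : ∀ (σ : G) (j : Fin n), j ∉ U ∪ V → Equiv.Perm.ofSubtype σ j = j := fun σ j hj =>
    Equiv.Perm.ofSubtype_apply_of_not_mem σ hj
  have hmem : ∀ σ : G, ∀ d ∈ C, d ∘ Equiv.Perm.ofSubtype σ ∈ C := by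
    intro σ d hd
    have h := (Finset.mem_filter.1 hd).2
    rw [hC, Finset.mem_filter]
    refine ⟨Finset.mem_univ _, ?_⟩
    rw [← h]
    have hiff : ∀ j, ((d ∘ Equiv.Perm.ofSubtype σ) j).1 ≠ ((d ∘ Equiv.Perm.ofSubtype σ) j).2 ↔
        (d j).1 ≠ (d j).2 := by
      intro j
      by_cases hj : j ∈ U ∪ V
      · exact iff_of_true (hne d hd _ (hmemG σ j hj)) (hne d hd j hj)
      · rw [Function.comp_apply, hfix σ j hj]
    exact Prod.ext (Finset.filter_congr fun j _ => and_congr_left' (hiff j))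
      (Finset.filter_congr fun j _ => and_congr_left' (hiff j))
  have hprod : ∀ σ : G, ∀ d ∈ C, ∏ j, (q j ((d ∘ Equiv.Perm.ofSubtype σ) j)).toReal =
      ∏ j, (q j (d j)).toReal := by
    intro σ d hd
    refine Finset.prod_congr rfl fun j _ => ?_
    by_cases hj : j ∈ U ∪ V
    · have h1 := hne d hd _ (hmemG σ j hj)
      have h2 := hne d hd j hj
      have hval : ∀ z : Bool × Bool, z.1 ≠ z.2 →
          (q j z).toReal = (q j (true, false)).toReal := by
        rintro ⟨x, y⟩ hxy
        cases x <;> cases y <;> simp_all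
      rw [Function.comp_apply, hval _ h1, hval _ h2]
    · rw [Function.comp_apply, hfix σ j hj]
  have hact : ∀ (σ : G) (F : (Fin n → Bool × Bool) → ℝ),
      ∑ d ∈ C, F (d ∘ Equiv.Perm.ofSubtype σ) = ∑ d ∈ C, F d := by
    intro σ F
    refine Finset.sum_nbij' (fun d => d ∘ Equiv.Perm.ofSubtype σ)
      (fun d => d ∘ Equiv.Perm.ofSubtype σ⁻¹) (hmem σ) (hmem σ⁻¹) ?_ ?_ (fun _ _ => rfl)
    · intro d _
      funext j
      simp
    · intro d _
      funext j
      simp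
  refine le_of_mul_le_mul_left ?_ hGpos
  calc (Fintype.card G : ℝ) * ∑ d ∈ C, (if permutationPValue U V (fun j => num (d j).1) ≤ α then
          ∏ j, (q j (d j)).toReal else 0)
      = ∑ σ : G, ∑ d ∈ C, (if permutationPValue U V
          ((fun j => num (d j).1) ∘ Equiv.Perm.ofSubtype σ) ≤ α then
          ∏ j, (q j (d j)).toReal else 0) := by
        rw [← nsmul_eq_mul, ← Finset.card_univ, ← Finset.sum_const]
        refine Finset.sum_congr rfl fun σ _ => ?_
        rw [← hact σ]
        refine Finset.sum_congr rfl fun d hd => ?_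
        rw [hprod σ d hd]
        rfl
    _ = ∑ d ∈ C, (∏ j, (q j (d j)).toReal) * ((Finset.univ.filter fun σ : G =>
          permutationPValue U V ((fun j => num (d j).1) ∘ Equiv.Perm.ofSubtype σ) ≤ α).card : ℝ) := by
        rw [Finset.sum_comm]
        refine Finset.sum_congr rfl fun d _ => ?_
        rw [← Finset.sum_filter, Finset.sum_const, nsmul_eq_mul, mul_comm]
    _ ≤ ∑ d ∈ C, (∏ j, (q j (d j)).toReal) * (α * Fintype.card G) := by
        refine Finset.sum_le_sum fun d _ => ?_
        gcongr
        exact card_permutationPValue_le U V _ hα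
    _ = _ := by rw [← Finset.sum_mul]; ring

theorem disagreement_toOuterMeasure_le (q : Fin n → PMF (Bool × Bool))
    (hq : ∀ j, (q j (true, false)).toReal = (q j (false, true)).toReal)
    (J : Finset (Fin n)) (a : PairAssignment n m) {α : ℝ} (hα : 0 ≤ α) :
    (independent q).toOuterMeasure {d | disagreementRejects α (tupleOf J a d)} ≤
      ENNReal.ofReal α := by
  classical
  rw [independent_toOuterMeasure]
  refine ENNReal.ofReal_le_ofReal ?_
  have hnn : ∀ d : Fin n → Bool × Bool, 0 ≤ ∏ j, (q j (d j)).toReal := fun d =>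
    Finset.prod_nonneg fun _ _ => ENNReal.toReal_nonneg
  -- Dropping the nonemptiness conditions only enlarges the rejection region; then the outcomes are
  -- grouped by their disagreement sets.
  calc _ ≤ ∑ d : Fin n → Bool × Bool,
        (if permutationPValue (disagreements J a d).1 (disagreements J a d).2
          (fun j => num (d j).1) ≤ α then ∏ j, (q j (d j)).toReal else 0) := by
        refine Finset.sum_le_sum fun d _ => ?_
        by_cases h : disagreementRejects α (tupleOf J a d)
        · have h' : permutationPValue (disagreements J a d).1 (disagreements J a d).2
              (fun j => num (d j).1) ≤ α := h.2.2
          rw [if_pos (show d ∈ {d | disagreementRejects α (tupleOf J a d)} from h), if_pos h']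
        · rw [if_neg (show d ∉ {d | disagreementRejects α (tupleOf J a d)} from h)]
          split_ifs
          · exact hnn d
          · exact le_rfl
    _ = ∑ UV : Finset (Fin n) × Finset (Fin n), ∑ d with disagreements J a d = UV,
        (if permutationPValue UV.1 UV.2 (fun j => num (d j).1) ≤ α then
          ∏ j, (q j (d j)).toReal else 0) := by
        rw [← Finset.sum_fiberwise Finset.univ (disagreements J a)]
        refine Finset.sum_congr rfl fun UV _ => Finset.sum_congr rfl fun d hd => ?_
        rw [(Finset.mem_filter.1 hd).2]
    _ ≤ ∑ UV : Finset (Fin n) × Finset (Fin n),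
        α * ∑ d with disagreements J a d = UV, ∏ j, (q j (d j)).toReal :=
        Finset.sum_le_sum fun UV _ => sum_pValue_le q hq J a hα UV.1 UV.2
    _ = α := by
        rw [← Finset.mul_sum, Finset.sum_fiberwise Finset.univ (disagreements J a),
          sum_prod_eq_prod_sum fun j x => (q j x).toReal]
        have : ∀ j, ∑ x, (q j x).toReal = 1 := fun j => by
          rw [← ENNReal.toReal_sum fun x _ => (q j).apply_ne_top x, sum_pmf_eq_one,
            ENNReal.toReal_one]
        simp [this]

theorem meanDiff_eq_sum_weights {U V : Finset (Fin n)} (hd : Disjoint U V) (f : Fin n → ℝ) :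
    meanDiff U V f =
      ∑ j, (if j ∈ U then (U.card : ℝ)⁻¹ else if j ∈ V then -(V.card : ℝ)⁻¹ else 0) * f j := by
  have h : ∀ j, (if j ∈ U then (U.card : ℝ)⁻¹ else if j ∈ V then -(V.card : ℝ)⁻¹ else 0) * f j =
      (if j ∈ U then (U.card : ℝ)⁻¹ * f j else 0) -
        (if j ∈ V then (V.card : ℝ)⁻¹ * f j else 0) := by
    intro j
    by_cases hU : j ∈ U
    · simp [hU, Finset.disjoint_left.1 hd hU]
    · by_cases hV : j ∈ V <;> simp [hU, hV]
  simp only [h, Finset.sum_sub_distrib, Finset.sum_ite_mem, Finset.univ_inter, ← Finset.mul_sum,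
    meanDiff, div_eq_inv_mul]

theorem sum_weights_sq {U V : Finset (Fin n)} (hd : Disjoint U V) :
    ∑ j, (if j ∈ U then (U.card : ℝ)⁻¹ else if j ∈ V then -(V.card : ℝ)⁻¹ else 0) ^ 2 =
      (U.card : ℝ)⁻¹ + (V.card : ℝ)⁻¹ := by
  have h : ∀ j, (if j ∈ U then (U.card : ℝ)⁻¹ else if j ∈ V then -(V.card : ℝ)⁻¹ else 0) ^ 2 =
      (if j ∈ U then (U.card : ℝ)⁻¹ ^ 2 else 0) + (if j ∈ V then (V.card : ℝ)⁻¹ ^ 2 else 0) := by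
    intro j
    by_cases hU : j ∈ U
    · simp [hU, Finset.disjoint_left.1 hd hU]
    · by_cases hV : j ∈ V <;> simp [hU, hV]
  -- The convention that the inverse of 0 is 0 covers empty sets.
  have hc : ∀ x : ℝ, x * x⁻¹ ^ 2 = x⁻¹ := fun x => by
    by_cases hx : x = 0
    · simp [hx]
    · field_simp
  simp only [h, Finset.sum_add_distrib, Finset.sum_ite_mem, Finset.univ_inter, Finset.sum_const,
    nsmul_eq_mul, hc]

theorem toOuterMeasure_lt_abs_meanDiff_le (q : Fin n → PMF (Bool × Bool))
    (hq : ∀ j, (q j (true, false)).toReal = (q j (false, true)).toReal)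
    {U V : Finset (Fin n)} (hd : Disjoint U V) (hU : U.Nonempty) {α : ℝ}
    (hα : α ∈ Set.Ioo (0 : ℝ) 1) :
    (independent q).toOuterMeasure {d |
      Real.sqrt (2 * ((U.card : ℝ)⁻¹ + (V.card : ℝ)⁻¹) * Real.log (2 / α)) <
        |meanDiff U V fun j => diff (d j)|} ≤ ENNReal.ofReal α := by
  set w : Fin n → ℝ := fun j =>
    if j ∈ U then (U.card : ℝ)⁻¹ else if j ∈ V then -(V.card : ℝ)⁻¹ else 0 with hw
  set K := (U.card : ℝ)⁻¹ + (V.card : ℝ)⁻¹ with hK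
  have hwK : ∑ j, w j ^ 2 = K := sum_weights_sq hd
  have hKpos : 0 < K := by
    have : (0 : ℝ) < U.card := by exact_mod_cast hU.card_pos
    positivity
  have hlog : 0 < Real.log (2 / α) :=
    Real.log_pos (by rw [lt_div_iff₀ hα.1]; linarith [hα.2])
  set T := Real.sqrt (2 * K * Real.log (2 / α)) with hT
  have hT2 : T ^ 2 = 2 * K * Real.log (2 / α) := Real.sq_sqrt (by positivity)
  -- One tail for each sign `e`. The scale `s = T / K` minimizes `s ^ 2 * K / 2 - s * T`, with value
  -- `-T ^ 2 / (2 * K) = -log (2 / α)`.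
  have htail : ∀ e : ℝ, e ^ 2 = 1 → (independent q).toOuterMeasure
      {d | T ^ 2 / K ≤ ∑ j, T / K * e * w j * diff (d j)} ≤ ENNReal.ofReal (α / 2) := by
    intro e he
    refine (chernoff q (fun j x => T / K * e * w j * diff x)
      (fun j => (T / K * e * w j) ^ 2 / 2)
      (fun j => sum_exp_diff_le_of_symm (hq j) _) (T ^ 2 / K)).trans ?_
    refine ENNReal.ofReal_le_ofReal (le_of_eq ?_)
    have : ∑ j, (T / K * e * w j) ^ 2 / 2 - T ^ 2 / K = -Real.log (2 / α) := by
      simp only [mul_pow, he]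
      rw [← Finset.sum_div, ← Finset.mul_sum, hwK, div_pow, hT2]
      field_simp
      ring
    rw [this, ← Real.log_inv, Real.exp_log (inv_pos.2 (div_pos two_pos hα.1)), inv_div]
  have hsub : {d | T < |meanDiff U V fun j => diff (d j)|} ⊆
      {d : Fin n → Bool × Bool | T ^ 2 / K ≤ ∑ j, T / K * 1 * w j * diff (d j)} ∪
      {d | T ^ 2 / K ≤ ∑ j, T / K * (-1) * w j * diff (d j)} := by
    intro d hd'
    have hTK : 0 ≤ T / K := div_nonneg (Real.sqrt_nonneg _) hKpos.le
    have hmean : meanDiff U V (fun j => diff (d j)) = ∑ j, w j * diff (d j) :=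
      meanDiff_eq_sum_weights hd _
    have hsum : ∀ e : ℝ, ∑ j, T / K * e * w j * diff (d j) =
        T / K * (e * meanDiff U V fun j => diff (d j)) := fun e => by
      rw [hmean, Finset.mul_sum, Finset.mul_sum]
      exact Finset.sum_congr rfl fun j _ => by ring
    have hsq : T ^ 2 / K = T / K * T := by ring
    simp only [Set.mem_union, Set.mem_ofPred_eq, hsum, hsq] at hd' ⊢
    rcases lt_abs.1 hd' with h | h
    · exact Or.inl (mul_le_mul_of_nonneg_left (by linarith) hTK)
    · exact Or.inr (mul_le_mul_of_nonneg_left (by linarith) hTK)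
  refine (MeasureTheory.measure_mono hsub).trans ((MeasureTheory.measure_union_le _ _).trans ?_)
  refine (add_le_add (htail 1 (by norm_num)) (htail (-1) (by norm_num))).trans ?_
  rw [← ENNReal.ofReal_add (by linarith [hα.1]) (by linarith [hα.1]), add_halves]

/-- The index sets depend on the partial assignment only, not on the decisions, so no conditioning
is needed. -/
theorem counting_toOuterMeasure_le (q : Fin n → PMF (Bool × Bool))
    (hq : ∀ j, (q j (true, false)).toReal = (q j (false, true)).toReal)
    (J : Finset (Fin n)) (a : PairAssignment n m) {α : ℝ} (hα : α ∈ Set.Ioo (0 : ℝ) 1) :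
    (independent q).toOuterMeasure {d | countingRejects α (tupleOf J a d)} ≤
      ENNReal.ofReal α := by
  set P := Finset.univ.filter fun j => (a j).isSome with hP
  set U := P.filter fun j => (if j ∈ J then (1 : ℤ) else -1) = 1 with hU
  set V := P.filter fun j => (if j ∈ J then (1 : ℤ) else -1) = -1 with hV
  by_cases hne : U.Nonempty
  · have hd : Disjoint U V := Finset.disjoint_filter.2 fun j _ h => by rw [h]; norm_num
    exact (MeasureTheory.measure_mono fun d h => h.2.2).trans
      (toOuterMeasure_lt_abs_meanDiff_le q hq hd hne hα)
  · have : {d | countingRejects α (tupleOf J a d)} = ∅ :=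
      Set.eq_empty_of_forall_notMem fun d h => hne h.1
    rw [this]
    simp

theorem controlsTypeIError_of (lam mu : ℕ) (α : ℝ) (reject : ∀ {n : ℕ}, TupleSet n → Prop)
    (h : ∀ {n m : ℕ} (q : Fin n → PMF (Bool × Bool)),
      (∀ j, (q j (true, false)).toReal = (q j (false, true)).toReal) →
      ∀ (J : Finset (Fin n)) (a : PairAssignment n m),
        (independent q).toOuterMeasure {d | reject (tupleOf J a d)} ≤ ENNReal.ofReal α) :
    ControlsTypeIError lam mu α reject := by
  intro n m J β D M Psb Pdb _ hD hM h0
  refine bind_toOuterMeasure_le _ _ _ _ fun b hb => bind_toOuterMeasure_le _ _ _ _ fun a ha => ?_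
  obtain ⟨PR, hPR, haPR⟩ := (PMF.mem_support_bind_iff _ _ _).1 ha
  rw [law_of_tuples hD hM hb ha (hD.assign b hb PR hPR a haPR), PMF.toOuterMeasure_map_apply]
  exact h (pairLaw M a) (pairLaw_symm hM h0 a) J a

/-! ## Power -/

/-- The papers of the partial assignment that satisfy the property. -/
def pairedIn (J : Finset (Fin n)) (a : PairAssignment n m) : Finset (Fin n) :=
  (tupleOf J a fun _ => (false, false)).papers.filter fun j => (if j ∈ J then (1 : ℤ) else -1) = 1

/-- The papers of the partial assignment that do not satisfy the property. -/
def pairedOut (J : Finset (Fin n)) (a : PairAssignment n m) : Finset (Fin n) :=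
  (tupleOf J a fun _ => (false, false)).papers.filter fun j => (if j ∈ J then (1 : ℤ) else -1) = -1

theorem mem_pairedIn {J : Finset (Fin n)} {a : PairAssignment n m} {j : Fin n} :
    j ∈ pairedIn J a ↔ (a j).isSome ∧ j ∈ J := by
  by_cases h : j ∈ J <;> simp [pairedIn, tupleOf, h]

theorem mem_pairedOut {J : Finset (Fin n)} {a : PairAssignment n m} {j : Fin n} :
    j ∈ pairedOut J a ↔ (a j).isSome ∧ j ∉ J := by
  by_cases h : j ∈ J <;> simp [pairedOut, tupleOf, h]

/-- The tail bound for the sum of the differences over a set of papers with a gap. -/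
theorem toOuterMeasure_sum_diff_le (q : Fin n → PMF (Bool × Bool)) {e δ : ℝ}
    (he : e = 1 ∨ e = -1) (hδ : 0 < δ) (B : Finset (Fin n))
    (hq : ∀ j ∈ B, δ ≤ e * ((q j (true, false)).toReal - (q j (false, true)).toReal)) :
    (independent q).toOuterMeasure {d | e * ∑ j ∈ B, diff (d j) ≤ δ / 2 * B.card} ≤
      ENNReal.ofReal (Real.exp (-(δ ^ 2 / 16) * B.card)) := by
  classical
  have h := chernoff q (fun j x => if j ∈ B then -(δ / 4) * e * diff x else 0)
    (fun j => if j ∈ B then -(3 * δ ^ 2 / 16) else 0) (fun j => by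
      by_cases hj : j ∈ B
      · simpa only [hj, if_true] using sum_exp_diff_le_of_gap he hδ (hq j hj)
      · simp only [hj, if_false, Real.exp_zero, mul_one]
        rw [← ENNReal.toReal_sum fun x _ => (q j).apply_ne_top x, sum_pmf_eq_one,
          ENNReal.toReal_one]) (-(δ ^ 2 / 8 * B.card))
  refine (MeasureTheory.measure_mono fun d hd => ?_).trans (h.trans
    (ENNReal.ofReal_le_ofReal (Real.exp_le_exp.2 (le_of_eq ?_))))
  · simp only [Set.mem_ofPred_eq, Finset.sum_ite_mem, Finset.univ_inter, ← Finset.mul_sum] at hd ⊢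
    nlinarith
  · simp only [Finset.sum_ite_mem, Finset.univ_inter, Finset.sum_const, nsmul_eq_mul]
    ring

/-- Exchange argument: if fewer than `N` selected papers were in `J`, swapping a selected paper
outside `J` for an unselected one in `J` would lower the imbalance by 2 without changing its sign,
as `k` is large. -/
theorem card_inter_ge_of_isBalancedSelection {J P : Finset (Fin n)} {k N : ℕ}
    (hP : IsBalancedSelection J k P) (hJ : N ≤ J.card) (hk : 2 * N + 1 ≤ k) :
    N ≤ (P ∩ J).card := by
  by_contra! hlt
  have hsum := Finset.card_inter_add_card_sdiff P J
  have hPk := hP.1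
  obtain ⟨x, hxJ, hxP⟩ : ∃ x ∈ J, x ∉ P := by
    by_contra! h
    rw [Finset.inter_eq_right.2 h] at hlt
    omega
  obtain ⟨y, hy⟩ : (P \ J).Nonempty := Finset.card_pos.1 (by omega)
  obtain ⟨hyP, hyJ⟩ := Finset.mem_sdiff.1 hy
  have hxy : x ≠ y := fun h => hxP (h ▸ hyP)
  have hx' : x ∉ P.erase y := fun h => hxP (Finset.mem_of_mem_erase h)
  have hQ : (insert x (P.erase y)).card = k := by
    rw [Finset.card_insert_of_notMem hx', Finset.card_erase_of_mem hyP]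
    omega
  have h1 : insert x (P.erase y) ∩ J = insert x (P ∩ J) := by
    ext z
    simp only [Finset.mem_inter, Finset.mem_insert, Finset.mem_erase]
    constructor
    · rintro ⟨rfl | h, hz⟩
      · exact Or.inl rfl
      · exact Or.inr ⟨h.2, hz⟩
    · rintro (rfl | h)
      · exact ⟨Or.inl rfl, hxJ⟩
      · exact ⟨Or.inr ⟨fun hzy => hyJ (hzy ▸ h.2), h.1⟩, h.2⟩
  have h1c : (insert x (P.erase y) ∩ J).card = (P ∩ J).card + 1 := by
    rw [h1, Finset.card_insert_of_notMem fun h => hxP (Finset.mem_inter.1 h).1]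
  have hsum' := Finset.card_inter_add_card_sdiff (insert x (P.erase y)) J
  have hbal := hP.2 _ hQ
  rw [abs_of_nonpos (by omega), abs_of_nonpos (by omega)] at hbal
  omega

theorem isBalancedSelection_compl {J P : Finset (Fin n)} {k : ℕ}
    (hP : IsBalancedSelection J k P) : IsBalancedSelection Jᶜ k P := by
  have h : ∀ Q : Finset (Fin n), |((Q ∩ Jᶜ).card : ℤ) - ((Q \ Jᶜ).card : ℤ)| =
      |((Q ∩ J).card : ℤ) - ((Q \ J).card : ℤ)| := by
    intro Q
    rw [abs_sub_comm, ← Finset.sdiff_eq_inter_compl, _root_.sdiff_compl]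
    rfl
  exact ⟨hP.1, fun Q hQ => by rw [h, h]; exact hP.2 Q hQ⟩

theorem IsCompletion.load_le {lam mu : ℕ} {a : PairAssignment n m} {S : Finset (Fin m)}
    {A : Fin n → Finset (Fin m)} (h : IsCompletion lam mu a S A) : n * (2 * lam) ≤ m * mu := by
  have hA : ∀ j, (A j).card = 2 * lam := fun j => by
    rw [← Finset.card_inter_add_card_sdiff (A j) S, h.sb_load, h.db_load, two_mul]
  have hcount := Finset.sum_card_bipartiteAbove_eq_sum_card_bipartiteBelow
    (s := (Finset.univ : Finset (Fin n))) (t := (Finset.univ : Finset (Fin m)))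
    (fun j i => i ∈ A j)
  calc n * (2 * lam) = ∑ j, (A j).card := by simp [hA]
    _ = ∑ i : Fin m, (Finset.univ.filter fun j => i ∈ A j).card := by
        rw [← Finset.sum_congr rfl fun i _ => rfl]
        simpa [Finset.bipartiteAbove, Finset.bipartiteBelow] using hcount
    _ ≤ ∑ _i : Fin m, mu := Finset.sum_le_sum fun i _ => h.reviewer_load i
    _ = m * mu := by simp

/-- Only `m < 2 * n` needs an argument. There `load_le` with `m = 2 * k` gives `n * lam ≤ k * mu`,
so `k ≤ 2 * N` would contradict `hn`, and the balanced selection is large enough for the exchange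
argument. -/
theorem card_inter_pool_ge {β : Type} {D : Design n m β} {lam mu N : ℕ} {J : Finset (Fin n)}
    (hlam : 1 ≤ lam) (hm : Even m) (hD : D.IsValid lam mu J) (hJ : N ≤ J.card)
    (hJ' : N ≤ Jᶜ.card) (hn : mu * (2 * N + 1) < n) {b : β} (hb : b ∈ D.bidLaw.support)
    {PR : Finset (Fin n) × Finset (Fin m)} (hPR : PR ∈ (D.pool b).support) :
    N ≤ (PR.1 ∩ J).card ∧ N ≤ (PR.1 ∩ Jᶜ).card := by
  have hpool := hPR
  unfold Design.pool at hPR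
  split_ifs at hPR with h1 h2
  · obtain ⟨R, -, rfl⟩ := (PMF.mem_support_map_iff _ _ _).1 hPR
    simpa using ⟨hJ, hJ'⟩
  · obtain ⟨P, hP, rfl⟩ := (PMF.mem_support_map_iff _ _ _).1 hPR
    -- Every law has nonempty support, so some valid completion exists, and its loads bound `m` from
    -- below.
    obtain ⟨a, ha⟩ := (D.assign b P Finset.univ).support_nonempty
    have ha' : a ∈ (D.pairing b).support := (PMF.mem_support_bind_iff _ _ _).2 ⟨_, hpool, ha⟩
    obtain ⟨S, hS⟩ := (allocate a).support_nonempty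
    obtain ⟨A, hA⟩ := (D.complete b a S).support_nonempty
    have hload := (hD.complete b hb a ha' S hS A hA).load_le
    have hbal := hD.select h2 b hb P hP
    obtain ⟨k, rfl⟩ := hm
    have hk : (k + k) / 2 = k := by omega
    rw [hk] at hbal
    have hk' : 2 * N + 1 ≤ k := by
      by_contra! hlt
      have h3 : n ≤ n * lam := Nat.le_mul_of_pos_right n hlam
      have h4 : mu * k ≤ mu * (2 * N + 1) := Nat.mul_le_mul_left mu hlt.le
      nlinarith
    exact ⟨card_inter_ge_of_isBalancedSelection hbal hJ hk',
      card_inter_ge_of_isBalancedSelection (isBalancedSelection_compl hbal) hJ' hk'⟩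
  · rw [PMF.support_pure, Set.mem_singleton_iff] at hPR
    subst hPR
    simpa using ⟨hJ, hJ'⟩

theorem le_toOuterMeasure_of_compl {κ : Type*} (p : PMF κ) {s t : Set κ} {c : ℝ} (hc : 0 ≤ c)
    (hst : sᶜ ⊆ t) (ht : p.toOuterMeasure t ≤ ENNReal.ofReal c) :
    ENNReal.ofReal (1 - c) ≤ p.toOuterMeasure s := by
  rw [ENNReal.ofReal_sub _ hc, ENNReal.ofReal_one, tsub_le_iff_right]
  have huniv : p.toOuterMeasure Set.univ = 1 :=
    (PMF.toOuterMeasure_apply_eq_one_iff p Set.univ).2 (Set.subset_univ _)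
  rw [← huniv, ← Set.union_compl_self s]
  exact (MeasureTheory.measure_union_le s sᶜ).trans
    (add_le_add le_rfl ((MeasureTheory.measure_mono hst).trans ht))

/-- A test has non-trivial power if it rejects whenever there are many papers of both kinds and the
mean differences of the decisions are bounded away from `0` in the expected directions. -/
theorem hasNontrivialPower_of {lam mu : ℕ} (hlam : 1 ≤ lam) (hmu : 1 ≤ mu)
    (reject : ∀ {n : ℕ}, TupleSet n → Prop)
    (h : ∀ δ : ℝ, 0 < δ → ∃ N : ℕ, ∀ {n m : ℕ} (J : Finset (Fin n)) (a : PairAssignment n m)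
      (d : Fin n → Bool × Bool), N ≤ (pairedIn J a).card → N ≤ (pairedOut J a).card →
      δ / 2 * (pairedIn J a).card < ∑ j ∈ pairedIn J a, diff (d j) →
      δ / 2 * (pairedOut J a).card < -∑ j ∈ pairedOut J a, diff (d j) →
      reject (tupleOf J a d)) :
    HasNontrivialPower lam mu reject := by
  intro ε hε δ hδ
  obtain ⟨N₁, hN₁⟩ := h δ hδ
  obtain ⟨N₂, hN₂⟩ : ∃ N₂ : ℕ, ∀ N : ℕ, N₂ ≤ N →
      Real.exp (-(δ ^ 2 / 16) * N) ≤ ε / 2 := by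
    have hlim : Filter.Tendsto (fun N : ℕ => Real.exp (-(δ ^ 2 / 16) * N)) Filter.atTop
        (nhds 0) := by
      refine Real.tendsto_exp_atBot.comp ?_
      refine Filter.Tendsto.const_mul_atTop_of_neg ?_ tendsto_natCast_atTop_atTop
      have : 0 < δ ^ 2 := by positivity
      linarith
    exact Filter.eventually_atTop.1 (hlim.eventually (ge_mem_nhds (half_pos hε)))
  set N := max N₁ N₂
  -- This bound serves twice: it makes `n` large enough for `card_inter_pool_ge`, and as `1 ≤ mu` it
  -- gives at least `N` papers of each kind.
  refine ⟨mu * (2 * N + 1), fun n m J β D M Psb Pdb hm hD hM hn hH => ?_⟩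
  have hnJ := hn.trans_le (min_le_left _ _)
  have hnJ' := hn.trans_le (min_le_right _ _)
  have hNle : N ≤ mu * (2 * N + 1) := by nlinarith
  have hJn : J.card ≤ n := by simpa using Finset.card_le_univ J
  refine le_bind_toOuterMeasure _ _ _ _ fun b hb => le_bind_toOuterMeasure _ _ _ _ fun a ha => ?_
  obtain ⟨PR, hPR, haPR⟩ := (PMF.mem_support_bind_iff _ _ _).1 ha
  have hpair := hD.assign b hb PR hPR a haPR
  have hcard := card_inter_pool_ge hlam hm hD (hNle.trans hnJ.le) (hNle.trans hnJ'.le)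
    (hnJ.trans_le hJn) hb hPR
  have hin : PR.1 ∩ J = pairedIn J a := by
    ext j
    rw [mem_pairedIn, Finset.mem_inter, hpair.selected]
  have hout : PR.1 ∩ Jᶜ = pairedOut J a := by
    ext j
    rw [mem_pairedOut, Finset.mem_inter, hpair.selected, Finset.mem_compl]
  rw [hin, hout] at hcard
  rw [law_of_tuples hD hM hb ha hpair, PMF.toOuterMeasure_map_apply]
  have tail : ∀ (e : ℝ) (B : Finset (Fin n)), (e = 1 ∨ e = -1) → N ≤ B.card →
      (∀ j ∈ B, (a j).isSome) → (∀ j ∈ B, ∀ i, δ ≤ e * (Psb i j - Pdb i j)) →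
      (independent (pairLaw M a)).toOuterMeasure
        {d | e * ∑ j ∈ B, diff (d j) ≤ δ / 2 * B.card} ≤ ENNReal.ofReal (ε / 2) := by
    intro e B he hB hsome hgap
    refine (toOuterMeasure_sum_diff_le _ he hδ B fun j hj => ?_).trans
      (ENNReal.ofReal_le_ofReal (hN₂ _ ((le_max_right _ _).trans hB)))
    obtain ⟨r, hr⟩ := Option.isSome_iff_exists.1 (hsome j hj)
    rw [pairLaw_sub hM hr]
    linarith [hgap j hj r.1, hgap j hj r.2]
  have tin := tail 1 (pairedIn J a) (Or.inl rfl) hcard.1 (fun j hj => (mem_pairedIn.1 hj).1)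
    fun j hj i => by
      have h1 := hH.2 i j
      rw [abs_of_nonneg (sub_nonneg.2 ((hH.1.1 i j).1 (mem_pairedIn.1 hj).2))] at h1
      linarith
  have tout := tail (-1) (pairedOut J a) (Or.inr rfl) hcard.2 (fun j hj => (mem_pairedOut.1 hj).1)
    fun j hj i => by
      have h1 := hH.2 i j
      rw [abs_of_nonpos (sub_nonpos.2 ((hH.1.1 i j).2 (mem_pairedOut.1 hj).2))] at h1
      linarith
  refine le_toOuterMeasure_of_compl _ hε.le (fun d hd => ?_)
    ((MeasureTheory.measure_union_le _ _).trans ((add_le_add tin tout).trans (by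
      rw [← ENNReal.ofReal_add (by linarith) (by linarith), add_halves])))
  by_contra hnot
  simp only [Set.mem_union, Set.mem_ofPred_eq, not_or, not_le, one_mul, neg_mul] at hnot
  exact hd (hN₁ J a d ((le_max_left _ _).trans hcard.1) ((le_max_left _ _).trans hcard.2)
    hnot.1 hnot.2)

/-- The two means are more than `δ / 2` on opposite sides of 0, while the squared threshold is at
most `4 * log (2 / α) / N`. -/
theorem counting_power {α : ℝ} (hα : α ∈ Set.Ioo (0 : ℝ) 1) {δ : ℝ} (hδ : 0 < δ) :
    ∃ N : ℕ, ∀ {n m : ℕ} (J : Finset (Fin n)) (a : PairAssignment n m)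
      (d : Fin n → Bool × Bool), N ≤ (pairedIn J a).card → N ≤ (pairedOut J a).card →
      δ / 2 * (pairedIn J a).card < ∑ j ∈ pairedIn J a, diff (d j) →
      δ / 2 * (pairedOut J a).card < -∑ j ∈ pairedOut J a, diff (d j) →
      countingRejects α (tupleOf J a d) := by
  have hlog : 0 < Real.log (2 / α) :=
    Real.log_pos (by rw [lt_div_iff₀ hα.1]; linarith [hα.2])
  obtain ⟨N, hN⟩ := exists_nat_gt (4 * Real.log (2 / α) / δ ^ 2)
  have hNpos : (0 : ℝ) < N := lt_trans (by positivity) hN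
  have hNpos' : 0 < N := by exact_mod_cast hNpos
  refine ⟨N, fun {n m} J a d hU hV hSU hSV => ?_⟩
  set U := pairedIn J a
  set V := pairedOut J a
  have hU' : (N : ℝ) ≤ U.card := by exact_mod_cast hU
  have hV' : (N : ℝ) ≤ V.card := by exact_mod_cast hV
  have hUpos := hNpos.trans_le hU'
  have hVpos := hNpos.trans_le hV'
  refine ⟨Finset.card_pos.1 (hNpos'.trans_le hU), Finset.card_pos.1 (hNpos'.trans_le hV), ?_⟩
  change Real.sqrt (2 * ((U.card : ℝ)⁻¹ + (V.card : ℝ)⁻¹) * Real.log (2 / α)) <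
    |meanDiff U V fun j => diff (d j)|
  have hmean : δ < meanDiff U V fun j => diff (d j) := by
    have h1 : δ / 2 < (∑ j ∈ U, diff (d j)) / U.card := (lt_div_iff₀ hUpos).2 hSU
    have h2 : (∑ j ∈ V, diff (d j)) / V.card < -(δ / 2) := (div_lt_iff₀ hVpos).2 (by linarith)
    unfold meanDiff
    linarith
  refine lt_of_lt_of_le ?_ (hmean.le.trans (le_abs_self _))
  rw [Real.sqrt_lt' hδ]
  have h1 : (U.card : ℝ)⁻¹ ≤ (N : ℝ)⁻¹ := inv_anti₀ hNpos hU'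
  have h2 : (V.card : ℝ)⁻¹ ≤ (N : ℝ)⁻¹ := inv_anti₀ hNpos hV'
  calc 2 * ((U.card : ℝ)⁻¹ + (V.card : ℝ)⁻¹) * Real.log (2 / α)
      ≤ 2 * ((N : ℝ)⁻¹ + (N : ℝ)⁻¹) * Real.log (2 / α) := by gcongr
    _ = 4 * Real.log (2 / α) / N := by field_simp; ring
    _ < δ ^ 2 := by
        rw [div_lt_iff₀ (by positivity)] at hN ⊢
        linarith

/-- An agreement contributes 0 to the sum of differences and a disagreement contributes `2 * Y - 1`.
A large sum therefore forces both many disagreements and a mean SB decision at least `δ / 4` away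
from `1 / 2`, in opposite directions for the two kinds of papers. -/
theorem disagreement_power {α : ℝ} (hα : α ∈ Set.Ioo (0 : ℝ) 1) {δ : ℝ} (hδ : 0 < δ) :
    ∃ N : ℕ, ∀ {n m : ℕ} (J : Finset (Fin n)) (a : PairAssignment n m)
      (d : Fin n → Bool × Bool), N ≤ (pairedIn J a).card → N ≤ (pairedOut J a).card →
      δ / 2 * (pairedIn J a).card < ∑ j ∈ pairedIn J a, diff (d j) →
      δ / 2 * (pairedOut J a).card < -∑ j ∈ pairedOut J a, diff (d j) →
      disagreementRejects α (tupleOf J a d) := by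
  -- Inserting array sizes at least `δ / 2 * N` and a statistic at least `δ / 2` into
  -- `permutationPValue_le` gives `32 / (δ ^ 3 * N)`.
  obtain ⟨N, hN⟩ := exists_nat_gt (32 / δ ^ 3 / α)
  have hNpos : (0 : ℝ) < N := lt_trans (div_pos (by positivity) hα.1) hN
  refine ⟨N, fun {n m} J a d hU hV hSU hSV => ?_⟩
  have key : ∀ (B : Finset (Fin n)) (e : ℝ), (e = 1 ∨ e = -1) → N ≤ B.card →
      δ / 2 * B.card < e * ∑ j ∈ B, diff (d j) →
      δ / 2 * N ≤ ((B.filter fun j => (d j).1 ≠ (d j).2).card : ℝ) ∧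
      δ / 4 ≤ e * ((∑ j ∈ B with (d j).1 ≠ (d j).2, num (d j).1) /
        ((B.filter fun j => (d j).1 ≠ (d j).2).card : ℝ) - 1 / 2) := by
    intro B e he hB hS
    set W := B.filter fun j => (d j).1 ≠ (d j).2 with hW
    have hB' : (N : ℝ) ≤ B.card := by exact_mod_cast hB
    have hWB : (W.card : ℝ) ≤ B.card := by exact_mod_cast Finset.card_filter_le _ _
    have hsum : ∑ j ∈ B, diff (d j) = 2 * ∑ j ∈ W, num (d j).1 - W.card := by
      rw [Finset.mul_sum, ← nsmul_one, ← Finset.sum_const, ← Finset.sum_sub_distrib, hW,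
        Finset.sum_filter]
      refine Finset.sum_congr rfl fun j _ => ?_
      rcases d j with ⟨x, y⟩
      cases x <;> cases y <;> norm_num [diff, num]
    have h0 : 0 ≤ ∑ j ∈ W, num (d j).1 := Finset.sum_nonneg fun j _ => by
      unfold num; split_ifs <;> norm_num
    have h1 : ∑ j ∈ W, num (d j).1 ≤ W.card := by
      rw [← nsmul_one, ← Finset.sum_const]
      exact Finset.sum_le_sum fun j _ => by unfold num; split_ifs <;> norm_num
    rw [hsum] at hS
    have hle : e * (2 * ∑ j ∈ W, num (d j).1 - W.card) ≤ W.card := by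
      rcases he with rfl | rfl <;> linarith
    have hNB : δ / 2 * N ≤ δ / 2 * B.card := by gcongr
    -- Dividing by the size of `W` instead of `B` can only increase the deviation from `1 / 2`.
    have hNW : δ / 2 * W.card ≤ δ / 2 * B.card := by gcongr
    have hWpos : (0 : ℝ) < W.card := lt_of_lt_of_le (by positivity) (hNB.trans (hS.le.trans hle))
    refine ⟨hNB.trans (hS.le.trans hle), ?_⟩
    have : e * ((∑ j ∈ W, num (d j).1) / W.card - 1 / 2) =
        e * (2 * ∑ j ∈ W, num (d j).1 - W.card) / (2 * W.card) := by
      field_simp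
    rw [this, le_div_iff₀ (by positivity)]
    linarith
  obtain ⟨kU, mU⟩ := key (pairedIn J a) 1 (Or.inl rfl) hU (by linarith)
  obtain ⟨kV, mV⟩ := key (pairedOut J a) (-1) (Or.inr rfl) hV (by linarith)
  have hfst : (disagreements J a d).1 = (pairedIn J a).filter fun j => (d j).1 ≠ (d j).2 := by
    rw [pairedIn, Finset.filter_filter]
    exact Finset.filter_congr fun j _ => and_comm
  have hsnd : (disagreements J a d).2 = (pairedOut J a).filter fun j => (d j).1 ≠ (d j).2 := by
    rw [pairedOut, Finset.filter_filter]
    exact Finset.filter_congr fun j _ => and_comm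
  rw [← hfst] at kU mU
  rw [← hsnd] at kV mV
  have hNδ : 0 < δ / 2 * N := by positivity
  have hUpos := hNδ.trans_le kU
  have hVpos := hNδ.trans_le kV
  have hUne : (disagreements J a d).1.Nonempty := Finset.card_pos.1 (by exact_mod_cast hUpos)
  have hVne : (disagreements J a d).2.Nonempty := Finset.card_pos.1 (by exact_mod_cast hVpos)
  refine ⟨hUne, hVne, ?_⟩
  change permutationPValue (disagreements J a d).1 (disagreements J a d).2
    (fun j => num (d j).1) ≤ α
  have hmean : δ / 2 ≤ meanDiff (disagreements J a d).1 (disagreements J a d).2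
      (fun j => num (d j).1) := by
    unfold meanDiff
    linarith
  refine (permutationPValue_le hUne hVne _ (fun j => ?_) (half_pos hδ)
    (hmean.trans (le_abs_self _))).trans ?_
  · unfold num; split_ifs <;> norm_num
  have h1 := inv_anti₀ hNδ kU
  have h2 := inv_anti₀ hNδ kV
  calc 2 * (((disagreements J a d).1.card : ℝ)⁻¹ + ((disagreements J a d).2.card : ℝ)⁻¹) /
        (δ / 2) ^ 2 ≤ 2 * ((δ / 2 * N)⁻¹ + (δ / 2 * N)⁻¹) / (δ / 2) ^ 2 := by gcongr
    _ = 32 / δ ^ 3 / N := by field_simp; norm_num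
    _ ≤ α := by
        rw [div_le_iff₀ hNpos]
        rw [div_lt_iff₀ hα.1] at hN
        linarith

end BiasTest

end

theorem theorem1 (lam mu : ℕ) (hlam : 1 ≤ lam) (hmu : 1 ≤ mu) (α : ℝ) (hα : α ∈ Set.Ioo (0 : ℝ) 1) :
    (BiasTest.ControlsTypeIError lam mu α (BiasTest.disagreementRejects α) ∧
      BiasTest.HasNontrivialPower lam mu (BiasTest.disagreementRejects α)) ∧
    (BiasTest.ControlsTypeIError lam mu α (BiasTest.countingRejects α) ∧
      BiasTest.HasNontrivialPower lam mu (BiasTest.countingRejects α)) := by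
  refine ⟨⟨?_, ?_⟩, ?_, ?_⟩
  · exact BiasTest.controlsTypeIError_of lam mu α _ fun q hq J a =>
      BiasTest.disagreement_toOuterMeasure_le q hq J a hα.1.le
  · exact BiasTest.hasNontrivialPower_of hlam hmu _ fun δ hδ => BiasTest.disagreement_power hα hδ
  · exact BiasTest.controlsTypeIError_of lam mu α _ fun q hq J a =>
      BiasTest.counting_toOuterMeasure_le q hq J a hα
  · exact BiasTest.hasNontrivialPower_of hlam hmu _ fun δ hδ => BiasTest.counting_power hα hδ
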